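/- Let $M>0$ and let $\mathcal B=\mathbb R_t\times(0,2M)_r\times S^2$ be the black hole region of the Schwarzschild spacetime, with metric $ds^2=-f\,dt^2+f^{-1}dr^2+r^2(d\theta^2+\sin^2\theta\,d\phi^2)$, $f=1-2M/r<0$, time oriented so that $-\partial_r$ is future. Let $g=\theta+\int\frac{dr}{\sqrt{r(2M-r)}}$ (any antiderivative). Definitions. A level set of $g$ is $k$-future convex at a point $p$, where $\nabla^a g$ is future causal, if for every $k$-dimensional spacelike subspace $W$ of its tangent space at $p$ the $W$-trace $h^{\alpha\beta}e^a_\alpha e^b_\beta\nabla_a\nabla_b g$ is non-negative ($e_\alpha$ a basis of $W$, $h^{\alpha\beta}$ the inverse of $h_{\alpha\beta}=\langle e_\alpha,e_\beta\rangle$). $z_g^{(k)}$ is the largest open subset of $\mathcal B$ on which $g$ is $C^2$, $\nabla^a g$ is future causal and the level sets of $g$ are $k$-future convex; $z_g$ is the largest open subset on which $g$ is $C^2$, $\nabla^a g$ is future causal and $\nabla_a\nabla_b g$ is positive semi-definite on the tangent spaces of the level sets. The mean curvature vector of a spacelike submanifold is $H^b=-h^{\alpha\beta}(e^a_\alpha\nabla_a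 e^b_\beta)^\perp$. A closed trapped submanifold is a nonempty compact embedded spacelike submanifold without boundary whose $H$ is future timelike everywhere; it is called a closed trapped surface if its dimension is $2$ and a trapped loop if its dimension is $1$. Then: 1. For $0<\theta<\pi$, $\nabla^a g\,\partial_a=-\frac{2M-r}{r\sqrt{(2M-r)r}}\,\partial_r+\frac1{r^2}\,\partial_\theta$, and this vector is future null. 2. $z_g=z_g^{(1)}=\{(t,r,\theta,\phi): 0<r<2M,\ 0<\theta<\pi,\ \cot\theta>\sqrt{(2M-r)/r}\}$ and $z_g^{(2)}=\{(t,r,\theta,\phi): 0<r<2M,\ 0<\theta<\pi,\ \cot\theta>\frac{M-r}{\sqrt{r(2M-r)}}\}$. The inclusion $z_g^{(1)}\subset z_g^{(2)}$ is strict. 3. On the open set $z_g^{(2)}$ the (null) level sets of $g$ are 2-future convex, and $z_g^{(2)}$ contains no closed trapped surface. 4. Let $0<r_0<2M$ and $0<\theta_0<\pi$. The parallel $t=t_0$, $r=r_0$, $\theta=\theta_0$ has mean curvature vector $H=\frac{r_0-2M}{r_0^2}\,\partial_r+\frac{\cot\theta_0}{r_0^2}\,\partial_\theta$. It is a trapped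 loop if and only if $\cot^2\theta_0<\frac{2M-r_0}{r_0}$, equivalently $\sin^2\theta_0>\frac{r_0}{2M}$. It lies in $z_g^{(2)}$ if and only if $\cot\theta_0>\frac{M-r_0}{\sqrt{r_0(2M-r_0)}}$. If it is trapped, it is disjoint from $z_g^{(1)}$; if $\theta_0\le\pi/2$, it is disjoint from $z_g^{(1)}$ if and only if $\cot^2\theta_0\le\frac{2M-r_0}{r_0}$. 5. For every $t_0\in\mathbb R$ and $0<r_0<2M$ there is $\theta_0\in(0,\pi)$ with $\sin^2\theta_0>\frac{r_0}{2M}$ such that the parallel $t=t_0$, $r=r_0$, $\theta=\theta_0$ is a trapped loop contained in $z_g^{(2)}$, the region where closed trapped surfaces are forbidden. -/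

import Mathlib

open scoped ContDiff

noncomputable section

/-- The partial derivative `∂_a F` at `p`, for `F` defined on (a part of) `ℝᵐ`, with values in a
normed space. -/
def partialD {m : ℕ} {E : Type} [NormedAddCommGroup E] [NormedSpace ℝ E]
    (F : (Fin m → ℝ) → E) (a : Fin m) (p : Fin m → ℝ) : E :=
  fderiv ℝ F p (Pi.single a 1)

/-- A time oriented Lorentzian manifold (mostly plus signature) that is covered by a single chart:
an open set of `ℝᵐ` with a smooth Lorentzian metric, given by its components, and a continuous
timelike vector field which selects the future half cones. -/
structure CoordSpacetime (m : ℕ) where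
  carrier : Set (Fin m → ℝ)
  isOpen_carrier : IsOpen carrier
  /-- the components `g_{ab}` of the metric -/
  metric : (Fin m → ℝ) → Matrix (Fin m) (Fin m) ℝ
  smooth : ∀ a b, ContDiffOn ℝ ∞ (fun p => metric p a b) carrier
  symm : ∀ p ∈ carrier, (metric p).IsSymm
  /-- some vector is timelike, and the metric is positive definite on its orthogonal complement -/
  lorentzian : ∀ p ∈ carrier, ∃ v : Fin m → ℝ, v ⬝ᵥ (metric p).mulVec v < 0 ∧
    ∀ w : Fin m → ℝ, w ≠ 0 → v ⬝ᵥ (metric p).mulVec w = 0 → 0 < w ⬝ᵥ (metric p).mulVec w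
  /-- the time orientation -/
  timeDir : (Fin m → ℝ) → (Fin m → ℝ)
  continuous_timeDir : ContinuousOn timeDir carrier
  timelike_timeDir : ∀ p ∈ carrier, timeDir p ⬝ᵥ (metric p).mulVec (timeDir p) < 0

namespace CoordSpacetime

variable {m : ℕ} (X : CoordSpacetime m)

/-- `⟨v, w⟩ = g_{ab} v^a w^b` at `p`. -/
def inner (p v w : Fin m → ℝ) : ℝ := v ⬝ᵥ (X.metric p).mulVec w

/-- Future causal: nonzero, not spacelike, in the half cone of the time orientation. -/
def FutureCausal (p v : Fin m → ℝ) : Prop :=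
  v ≠ 0 ∧ X.inner p v v ≤ 0 ∧ X.inner p v (X.timeDir p) < 0

def FutureTimelike (p v : Fin m → ℝ) : Prop :=
  X.FutureCausal p v ∧ X.inner p v v < 0

def FutureNull (p v : Fin m → ℝ) : Prop :=
  X.FutureCausal p v ∧ X.inner p v v = 0

/-- The Christoffel symbols `Γ^c_{ab}` of the Levi-Civita connection. -/
def christoffel (p : Fin m → ℝ) (c a b : Fin m) : ℝ :=
  (1 / 2) * ∑ d, (X.metric p)⁻¹ c d *
    (partialD (fun q => X.metric q d b) a p + partialD (fun q => X.metric q d a) b p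
      - partialD (fun q => X.metric q a b) d p)

/-- The gradient `∇^c g = g^{cd} ∂_d g`. -/
def gradient (g : (Fin m → ℝ) → ℝ) (p : Fin m → ℝ) : Fin m → ℝ :=
  fun c => ∑ d, (X.metric p)⁻¹ c d * partialD g d p

/-- The covariant Hessian `v^a w^b ∇_a ∇_b g`. -/
def hessian (g : (Fin m → ℝ) → ℝ) (p v w : Fin m → ℝ) : ℝ :=
  ∑ a, ∑ b, v a * w b *
    (partialD (fun q => partialD g b q) a p - ∑ c, X.christoffel p c a b * partialD g c p)

/-- The matrix `h_{αβ} = ⟨e_α, e_β⟩`. It is positive definite exactly if the `e_α` are a basis of a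
`k`-dimensional spacelike subspace. -/
def gram {k : ℕ} (p : Fin m → ℝ) (e : Fin k → Fin m → ℝ) : Matrix (Fin k) (Fin k) ℝ :=
  Matrix.of fun α β => X.inner p (e α) (e β)

/-- The level set of `g` through `p` is `k`-future convex at `p`: for every `k`-dimensional
spacelike subspace `W` of its tangent space `ker dg` and every basis `e` of `W`,
`h^{αβ} e_α^a e_β^b ∇_a N_b ≥ 0`, where `N^a = ∇^a g` is the (future) normal. -/
def LevelSetFutureConvexAt (k : ℕ) (g : (Fin m → ℝ) → ℝ) (p : Fin m → ℝ) : Prop :=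
  ∀ e : Fin k → Fin m → ℝ, (∀ α, fderiv ℝ g p (e α) = 0) → (X.gram p e).PosDef →
    0 ≤ ∑ α, ∑ β, (X.gram p e)⁻¹ α β * X.hessian g p (e α) (e β)

/-- `Z` is an open subset of the spacetime on which `g` is `C²`, has future causal gradient, and has
`k`-future convex level sets. -/
def FoliatedByFutureConvex (k : ℕ) (g : (Fin m → ℝ) → ℝ) (Z : Set (Fin m → ℝ)) : Prop :=
  IsOpen Z ∧ Z ⊆ X.carrier ∧ ContDiffOn ℝ 2 g Z ∧
    ∀ p ∈ Z, X.FutureCausal p (X.gradient g p) ∧ X.LevelSetFutureConvexAt k g p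

/-- `z_g^{(k)}`: the maximal open set where `g` has future causal gradient and `k`-future convex
level sets. -/
def zSet (k : ℕ) (g : (Fin m → ℝ) → ℝ) : Set (Fin m → ℝ) :=
  ⋃₀ {Z | X.FoliatedByFutureConvex k g Z}

/-- `z_g`: the maximal open set where `g` has future causal gradient and the Hessian of `g` is
positive semi-definite on the tangent spaces of the level sets. -/
def zSetPSD (g : (Fin m → ℝ) → ℝ) : Set (Fin m → ℝ) :=
  ⋃₀ {Z | IsOpen Z ∧ Z ⊆ X.carrier ∧ ContDiffOn ℝ 2 g Z ∧
    ∀ p ∈ Z, X.FutureCausal p (X.gradient g p) ∧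
      ∀ v : Fin m → ℝ, fderiv ℝ g p v = 0 → 0 ≤ X.hessian g p v v}

/-- The coordinate tangent vectors `e_α = ∂x/∂u^α` of a parametrization `x`. -/
def frame {k : ℕ} (x : (Fin k → ℝ) → Fin m → ℝ) (u : Fin k → ℝ) : Fin k → Fin m → ℝ :=
  fun α => partialD x α u

/-- The components `∂_α∂_β x^c + Γ^c_{ab} e_α^a e_β^b` of `e_α^a ∇_a e_β`. -/
def covD {k : ℕ} (x : (Fin k → ℝ) → Fin m → ℝ) (u : Fin k → ℝ) (α β : Fin k) : Fin m → ℝ :=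
  fun c => partialD (fun w => partialD x β w) α u c +
    ∑ a, ∑ b, X.christoffel (x u) c a b * frame x u α a * frame x u β b

/-- The component of `v` normal to the span of the `e_α`. -/
def normalPart {k : ℕ} (p : Fin m → ℝ) (e : Fin k → Fin m → ℝ) (v : Fin m → ℝ) : Fin m → ℝ :=
  v - ∑ α, ∑ β, ((X.gram p e)⁻¹ α β * X.inner p v (e α)) • e β

/-- The mean curvature vector `H = - h^{αβ} (e_α^a ∇_a e_β)^⊥`, at the parameter `u`, of the
submanifold parametrized by `x`. -/
def meanCurvature {k : ℕ} (x : (Fin k → ℝ) → Fin m → ℝ) (u : Fin k → ℝ) : Fin m → ℝ :=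
  - ∑ α, ∑ β, (X.gram (x u) (frame x u))⁻¹ α β •
      X.normalPart (x u) (frame x u) (X.covD x u α β)

/-- `x : V → S` is a local parametrization of `S` as a `k`-dimensional embedded submanifold: a
smooth immersion of an open `V ⊆ ℝᵏ` that is a homeomorphism onto a relatively open subset
of `S`. -/
structure IsLocalParam (k : ℕ) (S : Set (Fin m → ℝ)) (V : Set (Fin k → ℝ))
    (x : (Fin k → ℝ) → Fin m → ℝ) : Prop where
  isOpen : IsOpen V
  contDiffOn : ContDiffOn ℝ ∞ x V
  immersion : ∀ u ∈ V, Function.Injective (fderiv ℝ x u)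
  embedding : Topology.IsEmbedding (V.domRestrict x)
  image : ∃ O : Set (Fin m → ℝ), IsOpen O ∧ x '' V = S ∩ O

/-- `S` is a `k`-dimensional closed (that is, compact and without boundary) trapped submanifold:
a nonempty compact `k`-dimensional embedded submanifold of the spacetime, spacelike, with future
timelike mean curvature vector everywhere. For `k = 1` it is a trapped loop, in codimension two a
closed trapped surface. (The mean curvature vector does not depend on the parametrization.) -/
def IsCTM (k : ℕ) (S : Set (Fin m → ℝ)) : Prop :=
  S.Nonempty ∧ IsCompact S ∧ S ⊆ X.carrier ∧
    ∀ p ∈ S, ∃ (V : Set (Fin k → ℝ)) (x : (Fin k → ℝ) → Fin m → ℝ) (u : Fin k → ℝ),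
      IsLocalParam k S V x ∧ u ∈ V ∧ x u = p ∧
        (X.gram p (frame x u)).PosDef ∧ X.FutureTimelike p (X.meanCurvature x u)

end CoordSpacetime

/-! ### The Schwarzschild interior

The black hole region is `ℝ_t × (0, 2M)_r × S²`. Through `(t, r, ω) ↦ (t, rω)` it is the open subset
`0 < |x| < 2M` of `ℝ × ℝ³`, with the axis included. -/

namespace Schwarzschild

/-- The area radius `r = |x|` at `p = (t, x)`. -/
def radius (p : Fin 4 → ℝ) : ℝ := Real.sqrt (p 1 ^ 2 + p 2 ^ 2 + p 3 ^ 2)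

/-- The polar angle `θ ∈ [0, π]`. -/
def polarAngle (p : Fin 4 → ℝ) : ℝ := Real.arccos (p 3 / radius p)

/-- The spherical coordinates `(t, r, θ, φ)`. -/
def sph (t r θ φ : ℝ) : Fin 4 → ℝ :=
  ![t, r * Real.sin θ * Real.cos φ, r * Real.sin θ * Real.sin φ, r * Real.cos θ]

/-- The coordinate vector fields of the spherical coordinates. -/
def dT (t r θ φ : ℝ) : Fin 4 → ℝ := deriv (fun s => sph s r θ φ) t
def dR (t r θ φ : ℝ) : Fin 4 → ℝ := deriv (fun s => sph t s θ φ) r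
def dTheta (t r θ φ : ℝ) : Fin 4 → ℝ := deriv (fun s => sph t r s φ) θ
def dPhi (t r θ φ : ℝ) : Fin 4 → ℝ := deriv (fun s => sph t r θ s) φ

/-- The components of the one-form `dt`. -/
def formT (a : Fin 4) : ℝ := if a = 0 then 1 else 0

/-- The components of the one-form `dr`. -/
def formR (p : Fin 4 → ℝ) (a : Fin 4) : ℝ := if a = 0 then 0 else p a / radius p

/-- The components of the flat metric `dx₁² + dx₂² + dx₃² = dr² + r² dΩ²`. -/
def flat (a b : Fin 4) : ℝ := if a = b ∧ a ≠ 0 then 1 else 0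

/-- `f = 1 - 2M/r`. -/
def lapse (M : ℝ) (p : Fin 4 → ℝ) : ℝ := 1 - 2 * M / radius p

/-- The Schwarzschild metric `-f dt² + f⁻¹ dr² + r² dΩ²`. -/
def metric (M : ℝ) (p : Fin 4 → ℝ) : Matrix (Fin 4) (Fin 4) ℝ :=
  Matrix.of fun a b => -lapse M p * (formT a * formT b) + (lapse M p)⁻¹ * (formR p a * formR p b)
    + (flat a b - formR p a * formR p b)

/-- The black hole region `0 < r < 2M`. -/
def region (M : ℝ) : Set (Fin 4 → ℝ) := {p | 0 < radius p ∧ radius p < 2 * M}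

theorem continuous_radius : Continuous radius := by unfold radius; fun_prop

theorem radius_sq (p : Fin 4 → ℝ) : radius p ^ 2 = p 1 ^ 2 + p 2 ^ 2 + p 3 ^ 2 :=
  Real.sq_sqrt (by positivity)

theorem contDiffAt_radius {p : Fin 4 → ℝ} (hp : 0 < radius p) : ContDiffAt ℝ ∞ radius p := by
  have h := Real.sqrt_pos.1 hp
  unfold radius
  refine ContDiffAt.sqrt ?_ h.ne'
  fun_prop

theorem lapse_neg {M : ℝ} {p : Fin 4 → ℝ} (hp : p ∈ region M) : lapse M p < 0 := by
  have : 1 < 2 * M / radius p := (one_lt_div hp.1).2 hp.2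
  unfold lapse; linarith

theorem metric_apply (M : ℝ) (p v w : Fin 4 → ℝ) :
    v ⬝ᵥ (metric M p).mulVec w = -lapse M p * (v 0 * w 0)
      + ((lapse M p)⁻¹ - 1) * ((v 1 * p 1 + v 2 * p 2 + v 3 * p 3) / radius p
        * ((w 1 * p 1 + w 2 * p 2 + w 3 * p 3) / radius p))
      + (v 1 * w 1 + v 2 * w 2 + v 3 * w 3) := by
  simp [metric, dotProduct, Matrix.mulVec, Fin.sum_univ_four, formT, formR, flat]
  ring

/-- The black hole region of the Schwarzschild spacetime of mass `M`, with `-∂_r` future. -/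
def blackHole (M : ℝ) : CoordSpacetime 4 where
  carrier := region M
  isOpen_carrier := (isOpen_lt continuous_const continuous_radius).inter
    (isOpen_lt continuous_radius continuous_const)
  metric := metric M
  smooth := by
    intro a b p hp
    refine ContDiffAt.contDiffWithinAt ?_
    have hr := contDiffAt_radius hp.1
    have hl : ContDiffAt ℝ ∞ (lapse M) p :=
      contDiffAt_const.sub (contDiffAt_const.div hr hp.1.ne')
    have hf : ∀ c, ContDiffAt ℝ ∞ (fun q => formR q c) p := by
      intro c
      unfold formR
      split_ifs
      · exact contDiffAt_const
      · exact ContDiffAt.div (by fun_prop) hr hp.1.ne'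
    exact ((hl.neg.mul contDiffAt_const).add
      ((hl.inv (lapse_neg hp).ne).mul ((hf a).mul (hf b)))).add
      (contDiffAt_const.sub ((hf a).mul (hf b)))
  symm := by
    intro p _
    ext a b
    simp only [Matrix.transpose_apply, metric, Matrix.of_apply, flat]
    have : (b = a ∧ b ≠ 0) = (a = b ∧ a ≠ 0) := by
      apply propext; constructor <;> (rintro ⟨rfl, h⟩; exact ⟨rfl, h⟩)
    simp only [this]
    ring
  lorentzian := by
    intro p hp
    have hf := lapse_neg hp
    have hr := hp.1
    have hr2 := radius_sq p
    refine ⟨![0, p 1, p 2, p 3], ?_, ?_⟩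
    · rw [metric_apply]
      have : p 1 * p 1 + p 2 * p 2 + p 3 * p 3 = radius p ^ 2 := by rw [hr2]; ring
      simp only [Matrix.cons_val_zero, Matrix.cons_val_one, Matrix.cons_val, this]
      have h1 : (lapse M p)⁻¹ < 0 := inv_neg''.2 hf
      have h2 : radius p ^ 2 / radius p = radius p := by field_simp
      rw [h2]
      nlinarith [mul_pos hr hr]
    · intro w hw h
      rw [metric_apply] at h ⊢
      have : p 1 * p 1 + p 2 * p 2 + p 3 * p 3 = radius p ^ 2 := by rw [hr2]; ring
      simp only [Matrix.cons_val_zero, Matrix.cons_val_one, Matrix.cons_val, this] at h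
      have h2 : radius p ^ 2 / radius p = radius p := by field_simp
      rw [h2] at h
      have h3 : radius p * ((w 1 * p 1 + w 2 * p 2 + w 3 * p 3) / radius p)
          = w 1 * p 1 + w 2 * p 2 + w 3 * p 3 := by field_simp
      rw [h3] at h
      have h4 : (lapse M p)⁻¹ * (w 1 * p 1 + w 2 * p 2 + w 3 * p 3) = 0 := by
        linear_combination h
      have h5 : w 1 * p 1 + w 2 * p 2 + w 3 * p 3 = 0 :=
        (mul_eq_zero.1 h4).resolve_left (inv_ne_zero hf.ne)
      rw [h5, zero_div, zero_mul, mul_zero, add_zero]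
      obtain ⟨i, hi⟩ := Function.ne_iff.1 hw
      have hi' : 0 < w i * w i := mul_self_pos.2 hi
      have q : ∀ j, 0 ≤ w j * w j := fun j => mul_self_nonneg _
      have q0 : 0 ≤ -lapse M p * (w 0 * w 0) := mul_nonneg (neg_pos.2 hf).le (q 0)
      have q1 := q 1
      have q2 := q 2
      have q3 := q 3
      by_cases hi0 : i = 0
      · subst hi0
        have := mul_pos (neg_pos.2 hf) hi'
        linarith
      · have : i = 1 ∨ i = 2 ∨ i = 3 := by omega
        rcases this with rfl | rfl | rfl <;> linarith
  timeDir := fun p a => -formR p a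
  continuous_timeDir := by
    refine continuousOn_pi.2 fun a => ?_
    by_cases ha : a = 0
    · simp only [formR, if_pos ha]
      exact continuousOn_const
    · simp only [formR, if_neg ha]
      exact ((continuous_apply a).continuousOn.div continuous_radius.continuousOn
        (fun p hp => hp.1.ne')).neg
  timelike_timeDir := by
    intro p hp
    have hf := lapse_neg hp
    have hr := hp.1
    have hr2 := radius_sq p
    have h1 : (lapse M p)⁻¹ < 0 := inv_neg''.2 hf
    rw [metric_apply]
    have e : ∀ a b c : ℝ, -(a / radius p) * a + -(b / radius p) * b + -(c / radius p) * c
        = -(a ^ 2 + b ^ 2 + c ^ 2) / radius p := by intros; ring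
    have e' : ∀ a b c : ℝ, -(a / radius p) * -(a / radius p) + -(b / radius p) * -(b / radius p)
        + -(c / radius p) * -(c / radius p) = (a ^ 2 + b ^ 2 + c ^ 2) / radius p ^ 2 := by
      intros; ring
    simp only [formR, if_true, show (1 : Fin 4) ≠ 0 by decide, show (2 : Fin 4) ≠ 0 by decide,
      show (3 : Fin 4) ≠ 0 by decide, if_false, e, e', ← hr2]
    have h2 : -radius p ^ 2 / radius p / radius p = -1 := by field_simp
    have h3 : radius p ^ 2 / radius p ^ 2 = 1 := by field_simp
    rw [h2, h3]
    linarith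

theorem dT_eq (t r θ φ : ℝ) : dT t r θ φ = ![1, 0, 0, 0] := by
  refine HasDerivAt.deriv (hasDerivAt_pi.2 fun i => ?_)
  fin_cases i
  · exact hasDerivAt_id t
  all_goals exact hasDerivAt_const _ _

theorem dR_eq (t r θ φ : ℝ) : dR t r θ φ =
    ![0, Real.sin θ * Real.cos φ, Real.sin θ * Real.sin φ, Real.cos θ] := by
  refine HasDerivAt.deriv (hasDerivAt_pi.2 fun i => ?_)
  fin_cases i
  · exact hasDerivAt_const _ _
  · simpa [sph] using ((hasDerivAt_id r).mul_const (Real.sin θ)).mul_const (Real.cos φ)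
  · simpa [sph] using ((hasDerivAt_id r).mul_const (Real.sin θ)).mul_const (Real.sin φ)
  · simpa [sph] using (hasDerivAt_id r).mul_const (Real.cos θ)

theorem dTheta_eq (t r θ φ : ℝ) : dTheta t r θ φ =
    ![0, r * Real.cos θ * Real.cos φ, r * Real.cos θ * Real.sin φ, -(r * Real.sin θ)] := by
  refine HasDerivAt.deriv (hasDerivAt_pi.2 fun i => ?_)
  fin_cases i
  · exact hasDerivAt_const _ _
  · simpa [sph] using ((Real.hasDerivAt_sin θ).const_mul r).mul_const (Real.cos φ)
  · simpa [sph] using ((Real.hasDerivAt_sin θ).const_mul r).mul_const (Real.sin φ)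
  · simpa [sph] using (Real.hasDerivAt_cos θ).const_mul r

theorem dPhi_eq (t r θ φ : ℝ) : dPhi t r θ φ =
    ![0, -(r * Real.sin θ * Real.sin φ), r * Real.sin θ * Real.cos φ, 0] := by
  refine HasDerivAt.deriv (hasDerivAt_pi.2 fun i => ?_)
  fin_cases i
  · exact hasDerivAt_const _ _
  · simpa [sph] using (Real.hasDerivAt_cos φ).const_mul (r * Real.sin θ)
  · simpa [sph] using (Real.hasDerivAt_sin φ).const_mul (r * Real.sin θ)
  · exact hasDerivAt_const _ _

theorem radius_sph {r : ℝ} (hr : 0 ≤ r) (t θ φ : ℝ) : radius (sph t r θ φ) = r := by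
  have : (r * Real.sin θ * Real.cos φ) ^ 2 + (r * Real.sin θ * Real.sin φ) ^ 2
      + (r * Real.cos θ) ^ 2 = r ^ 2 := by
    linear_combination (r ^ 2 * Real.sin θ ^ 2) * Real.sin_sq_add_cos_sq φ
      + r ^ 2 * Real.sin_sq_add_cos_sq θ
  simp [radius, sph, this, Real.sqrt_sq hr]

theorem polarAngle_sph {r θ : ℝ} (hr : 0 < r) (h0 : 0 ≤ θ) (h1 : θ ≤ Real.pi) (t φ : ℝ) :
    polarAngle (sph t r θ φ) = θ := by
  rw [polarAngle, radius_sph hr.le]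
  simp [sph, mul_div_cancel_left₀ _ hr.ne', Real.arccos_cos h0 h1]

/-- In spherical coordinates the metric is
`-(1 - 2M/r) dt² + (1 - 2M/r)⁻¹ dr² + r² (dθ² + sin²θ dφ²)`. -/
theorem inner_sph (M : ℝ) {r : ℝ} (hr : 0 < r) (t θ φ a b c d a' b' c' d' : ℝ) :
    (blackHole M).inner (sph t r θ φ)
      (a • dT t r θ φ + b • dR t r θ φ + c • dTheta t r θ φ + d • dPhi t r θ φ)
      (a' • dT t r θ φ + b' • dR t r θ φ + c' • dTheta t r θ φ + d' • dPhi t r θ φ)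
    = -(1 - 2 * M / r) * (a * a') + (1 - 2 * M / r)⁻¹ * (b * b')
      + r ^ 2 * (c * c' + Real.sin θ ^ 2 * (d * d')) := by
  have key : ∀ a b c d : ℝ,
      (b * (Real.sin θ * Real.cos φ) + c * (r * Real.cos θ * Real.cos φ)
        + d * (-(r * Real.sin θ * Real.sin φ))) * (r * Real.sin θ * Real.cos φ)
      + (b * (Real.sin θ * Real.sin φ) + c * (r * Real.cos θ * Real.sin φ)
        + d * (r * Real.sin θ * Real.cos φ)) * (r * Real.sin θ * Real.sin φ)
      + (b * Real.cos θ + c * (-(r * Real.sin θ))) * (r * Real.cos θ) = b * r := by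
    intro a b c d
    linear_combination (b * r * Real.sin θ ^ 2 + c * r ^ 2 * Real.sin θ * Real.cos θ)
      * Real.sin_sq_add_cos_sq φ + b * r * Real.sin_sq_add_cos_sq θ
  change _ ⬝ᵥ (metric M _).mulVec _ = _
  rw [metric_apply, lapse, radius_sph hr.le, dT_eq, dR_eq, dTheta_eq, dPhi_eq]
  simp only [sph, Pi.add_apply, Pi.smul_apply, smul_eq_mul, Matrix.cons_val_zero,
    Matrix.cons_val_one, Matrix.cons_val, mul_zero, mul_one, add_zero, zero_add,
    key a b c d, key a' b' c' d']
  rw [mul_div_cancel_right₀ _ hr.ne', mul_div_cancel_right₀ _ hr.ne']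
  linear_combination (b * b' * Real.sin θ ^ 2 + r * (b * c' + c * b') * Real.sin θ * Real.cos θ
      + r ^ 2 * c * c' * Real.cos θ ^ 2 + r ^ 2 * d * d' * Real.sin θ ^ 2)
      * Real.sin_sq_add_cos_sq φ + (b * b' + r ^ 2 * c * c') * Real.sin_sq_add_cos_sq θ

/-- The function `g = θ + ∫ dr / √(r (2M - r))`; here `h` is the antiderivative. -/
def foliation (h : ℝ → ℝ) (p : Fin 4 → ℝ) : ℝ := polarAngle p + h (radius p)

/-- The parallel `t = t₀, r = r₀, θ = θ₀`, as a parametrized curve (one period is `2π`). -/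
def parallelCurve (t₀ r₀ θ₀ : ℝ) (u : Fin 1 → ℝ) : Fin 4 → ℝ := sph t₀ r₀ θ₀ (u 0)

/-- The parallel `t = t₀, r = r₀, θ = θ₀`. -/
def parallel (t₀ r₀ θ₀ : ℝ) : Set (Fin 4 → ℝ) := Set.range (sph t₀ r₀ θ₀)

/-- The set of the points whose spherical coordinates (off the axis) satisfy `0 < r < 2M` and
`cot θ > F r`. -/
def cotRegion (M : ℝ) (F : ℝ → ℝ) : Set (Fin 4 → ℝ) :=
  {p | ∃ t r θ φ : ℝ, p = sph t r θ φ ∧ 0 < r ∧ r < 2 * M ∧ 0 < θ ∧ θ < Real.pi ∧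
    F r < Real.cot θ}

end Schwarzschild

end

noncomputable section

open Filter Topology

/-! Write `q = √((2M - r)/r)`, so that `f = -q²` and the antiderivative `h` has derivative `1/(rq)`.
The radial and angular contributions to the norm of `∇g` cancel, so `∇g` is null and its level sets
are null hypersurfaces, ruled by `∇g` itself. The Hessian of `g` vanishes along this generator. On
vectors `a ∂_t + b ∂_r + c ∂_θ + d ∂_φ` tangent to a level set it is the diagonal form `(1 +
q²)q/(2r²) a² + sin²θ (cot θ - q) d²` (`hessian_foliation_sphVec`), while the induced metric is `q²
a² + r² sin²θ d²`.

Everything about convexity is read off from these two forms. The first coefficient is positive, so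
positivity on lines, or on the whole tangent space, means `cot θ ≥ q`. Every spacelike 2-plane is
transverse to the generator, so all of them have the same trace `(cot θ - (q² - 1)/(2q))/r²`; here
the good `t`-direction compensates a bad `φ`-direction, and `(q² - 1)/(2q) = (M - r)/√(r(2M - r))`.
On the axis `g` has a conical singularity and is not differentiable. Off the axis `cot` is strictly
decreasing, so on an open set the weak inequalities become strict (`sUnion_isAdmissible`).

Closed trapped surfaces are excluded by a maximum principle
(`FoliatedByFutureConvex.not_subset_of_isCTM`): at a maximum of `g` on the surface, the trace of the
second derivatives of `g ∘ x` is at most zero, but it equals the trace of the Hessian, which is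
nonnegative, minus `dg(H)`, which is negative for `H` future timelike.

A parallel has `H` of squared norm `(cot²θ - q²)/r²` and always on the future side, so it is trapped
exactly for `|cot θ| < q`. Since `(q² - 1)/(2q) < q`, on every sphere some value of `cot θ` lies
below `q` and above both `-q` and the threshold of `z_g^{(2)}`. -/

/-! ### Second-order calculus at a local maximum -/

theorem partialD_apply_sum {m : ℕ} {E : Type} [NormedAddCommGroup E] [NormedSpace ℝ E]
    (F : (Fin m → ℝ) → E) (p v : Fin m → ℝ) : fderiv ℝ F p v = ∑ a, v a • partialD F a p := by
  conv_lhs => rw [pi_eq_sum_univ' v]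
  rw [map_sum]
  refine Finset.sum_congr rfl fun a _ => ?_
  rw [map_smul]
  rfl

/-- At a local maximum the second derivative is nonpositive. -/
theorem IsLocalMax.second_deriv_nonpos {f f' : ℝ → ℝ} {a c : ℝ}
    (hf : ∀ᶠ s in 𝓝 a, HasDerivAt f (f' s) s) (hf' : HasDerivAt f' c a) (hmax : IsLocalMax f a) :
    c ≤ 0 := by
  by_contra! hc
  have hd : deriv f =ᶠ[𝓝 a] f' := hf.mono fun s hs => hs.deriv
  have h2 : deriv (deriv f) a = c := by rw [hd.deriv_eq, hf'.deriv]
  -- A positive second derivative would make `a` a local minimum as well, so `f` would be locally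
  -- constant and its second derivative zero.
  have hmin : IsLocalMin f a := isLocalMin_of_deriv_deriv_pos (by rw [h2]; exact hc)
    hmax.deriv_eq_zero hf.self_of_nhds.continuousAt
  have hconst : f =ᶠ[𝓝 a] fun _ => f a := by
    filter_upwards [hmin, hmax] with s h1 h2 using le_antisymm h2 h1
  have h3 : deriv f =ᶠ[𝓝 a] fun _ => 0 := by
    simpa using hconst.deriv
  rw [h3.deriv_eq] at h2
  simp at h2
  linarith

theorem ContDiffAt.differentiableAt_partialD {m : ℕ} {E : Type} [NormedAddCommGroup E]
    [NormedSpace ℝ E] {F : (Fin m → ℝ) → E} {p : Fin m → ℝ} (hF : ContDiffAt ℝ 2 F p) (a : Fin m) :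
    DifferentiableAt ℝ (fun q => partialD F a q) p := by
  have h : ContDiffAt ℝ 1 (fderiv ℝ F) p := hF.fderiv_right (by norm_num)
  exact (h.differentiableAt (by norm_num)).clm_apply (differentiableAt_const _)

/-- Restriction to the line `u + s • v` reduces this to one variable. -/
theorem IsLocalMax.sum_partialD_partialD_nonpos {m : ℕ} {F : (Fin m → ℝ) → ℝ} {u : Fin m → ℝ}
    (hF : ContDiffAt ℝ 2 F u) (hmax : IsLocalMax F u) (v : Fin m → ℝ) :
    ∑ α, ∑ β, v α * v β * partialD (fun w => partialD F β w) α u ≤ 0 := by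
  have hc : ∀ s : ℝ, HasDerivAt (fun s : ℝ => u + s • v) v s := fun s => by
    simpa using ((hasDerivAt_id s).smul_const v).const_add u
  have hc0 : Tendsto (fun s : ℝ => u + s • v) (𝓝 0) (𝓝 u) := by
    simpa using (hc 0).continuousAt.tendsto
  have hev : ∀ᶠ w in 𝓝 u, DifferentiableAt ℝ F w :=
    (hF.eventually (by simp)).mono fun w hw => hw.differentiableAt (by norm_num)
  refine IsLocalMax.second_deriv_nonpos (f := fun s : ℝ => F (u + s • v)) (a := 0)
    (f' := fun s : ℝ => ∑ β, v β * partialD F β (u + s • v)) ?_ ?_ ?_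
  · filter_upwards [hc0.eventually hev] with s hs
    have := hs.hasFDerivAt.comp_hasDerivAt s (hc s)
    rw [partialD_apply_sum] at this
    exact this
  · have : ∀ β ∈ (Finset.univ : Finset (Fin m)), HasDerivAt
        (fun s : ℝ => v β * partialD F β (u + s • v))
        (v β * ∑ α, v α * partialD (fun w => partialD F β w) α u) 0 := by
      intro β _
      have hd : HasFDerivAt (fun w => partialD F β w) (fderiv ℝ (fun w => partialD F β w) u)
          (u + (0 : ℝ) • v) := by
        simpa using (hF.differentiableAt_partialD β).hasFDerivAt
      have := (hd.comp_hasDerivAt (0 : ℝ) (hc 0)).const_mul (v β)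
      rw [partialD_apply_sum] at this
      exact this
    refine (HasDerivAt.fun_sum this).congr_deriv ?_
    rw [Finset.sum_comm]
    refine Finset.sum_congr rfl fun β _ => ?_
    rw [Finset.mul_sum]
    exact Finset.sum_congr rfl fun α _ => by ring
  · simpa [IsLocalMax, IsMaxFilter] using hc0.eventually hmax

theorem partialD_comp {m k : ℕ} {g : (Fin m → ℝ) → ℝ} {x : (Fin k → ℝ) → Fin m → ℝ}
    {u : Fin k → ℝ} (hg : DifferentiableAt ℝ g (x u)) (hx : DifferentiableAt ℝ x u) (β : Fin k) :
    partialD (fun w => g (x w)) β u = ∑ b, partialD x β u b * partialD g b (x u) := by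
  have h := (hg.hasFDerivAt.comp u hx.hasFDerivAt).fderiv
  change fderiv ℝ (g ∘ x) u _ = _
  rw [h, ContinuousLinearMap.comp_apply, partialD_apply_sum]
  rfl

theorem partialD_pi {m k : ℕ} {y : (Fin k → ℝ) → Fin m → ℝ} {u : Fin k → ℝ}
    (hy : DifferentiableAt ℝ y u) (α : Fin k) (b : Fin m) :
    partialD (fun w => y w b) α u = partialD y α u b := by
  have := (hasFDerivAt_pi'.1 hy.hasFDerivAt b).fderiv
  rw [partialD, this]
  rfl

/-- The second derivatives of a composite function. -/
theorem partialD_partialD_comp {m k : ℕ} {g : (Fin m → ℝ) → ℝ} {x : (Fin k → ℝ) → Fin m → ℝ}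
    {u : Fin k → ℝ} (hg : ContDiffAt ℝ 2 g (x u)) (hx : ContDiffAt ℝ 2 x u) (α β : Fin k) :
    partialD (fun w => partialD (fun w => g (x w)) β w) α u =
      ∑ a, ∑ b, partialD x α u a * partialD x β u b * partialD (fun q => partialD g b q) a (x u)
        + ∑ b, partialD (fun w => partialD x β w) α u b * partialD g b (x u) := by
  have hxd := hx.differentiableAt (by norm_num)
  have hev : ∀ᶠ w in 𝓝 u, partialD (fun w => g (x w)) β w
      = ∑ b, partialD x β w b * partialD g b (x w) := by
    filter_upwards [hx.eventually (by simp),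
      hx.continuousAt.eventually (hg.eventually (by simp))] with w h1 h2
    exact partialD_comp (h2.differentiableAt (by norm_num)) (h1.differentiableAt (by norm_num)) β
  have hxβ := hx.differentiableAt_partialD β
  have h1 : ∀ b ∈ (Finset.univ : Finset (Fin m)), HasFDerivAt
      (fun w => partialD x β w b * partialD g b (x w))
      (partialD x β u b • fderiv ℝ (fun w => partialD g b (x w)) u
        + partialD g b (x u) • fderiv ℝ (fun w => partialD x β w b) u) u := by
    intro b _
    exact ((differentiableAt_pi.1 hxβ b).hasFDerivAt).mul
      ((hg.differentiableAt_partialD b).comp u hxd).hasFDerivAt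
  rw [partialD, EventuallyEq.fderiv_eq hev, (HasFDerivAt.fun_sum h1).fderiv,
    sum_apply, Finset.sum_comm, ← Finset.sum_add_distrib]
  refine Finset.sum_congr rfl fun b _ => ?_
  have h2 := partialD_comp (hg.differentiableAt_partialD b) hxd α
  have h3 := partialD_pi hxβ α b
  rw [partialD] at h2 h3
  simp only [add_apply, smul_apply, smul_eq_mul, h2, h3,
    Finset.mul_sum]
  congr 1
  · exact Finset.sum_congr rfl fun a _ => by ring
  · ring

-- Factoring `A⁻¹ = Bᵀ B` turns the trace into a sum of values of the quadratic form `N` on the rows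
-- of `B`.
open scoped MatrixOrder in
open scoped Matrix.Norms.L2Operator in
theorem Matrix.PosDef.sum_inv_mul_nonneg {k : ℕ} {A : Matrix (Fin k) (Fin k) ℝ} (hA : A.PosDef)
    {N : Fin k → Fin k → ℝ} (hN : ∀ v : Fin k → ℝ, 0 ≤ ∑ α, ∑ β, v α * v β * N α β) :
    0 ≤ ∑ α, ∑ β, A⁻¹ α β * N α β := by
  obtain ⟨B, hB⟩ := CStarAlgebra.nonneg_iff_eq_star_mul_self.1 hA.inv.posSemidef.nonneg
  have : ∑ α, ∑ β, A⁻¹ α β * N α β = ∑ γ, ∑ α, ∑ β, B γ α * B γ β * N α β := by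
    rw [hB]
    simp only [Matrix.mul_apply, Matrix.star_apply, star_trivial, Finset.sum_mul]
    rw [Finset.sum_comm]
    conv_lhs => enter [2, α]; rw [Finset.sum_comm]
    rw [Finset.sum_comm]
    exact Finset.sum_congr rfl fun γ _ => Finset.sum_comm
  rw [this]
  exact Finset.sum_nonneg fun γ _ => hN (B γ)

/-! ### The maximum principle for closed trapped submanifolds -/

namespace CoordSpacetime

variable {m : ℕ} (X : CoordSpacetime m)

/-- The tangential part that is subtracted is a combination of frame vectors, all in `ker dg`. This
is why the projection in the mean curvature is invisible to `dg` at a critical point. -/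
theorem fderiv_normalPart {k : ℕ} {g : (Fin m → ℝ) → ℝ} {p : Fin m → ℝ}
    {e : Fin k → Fin m → ℝ} (he : ∀ α, fderiv ℝ g p (e α) = 0) (v : Fin m → ℝ) :
    fderiv ℝ g p (X.normalPart p e v) = fderiv ℝ g p v := by
  simp [normalPart, map_sum, he]

/-- The Christoffel terms of the covariant Hessian and of `covD` cancel, which leaves the chain rule
for second derivatives. -/
theorem hessian_frame_add_fderiv_covD {k : ℕ} {g : (Fin m → ℝ) → ℝ}
    {x : (Fin k → ℝ) → Fin m → ℝ} {u : Fin k → ℝ} (hg : ContDiffAt ℝ 2 g (x u))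
    (hx : ContDiffAt ℝ 2 x u) (α β : Fin k) :
    X.hessian g (x u) (frame x u α) (frame x u β) + fderiv ℝ g (x u) (X.covD x u α β)
      = partialD (fun w => partialD (fun w => g (x w)) β w) α u := by
  rw [partialD_partialD_comp hg hx, partialD_apply_sum]
  simp only [hessian, covD, frame, smul_eq_mul, mul_sub, Finset.sum_sub_distrib, add_mul,
    Finset.sum_add_distrib, Finset.mul_sum, Finset.sum_mul]
  have : ∑ c, ∑ a, ∑ b, X.christoffel (x u) c a b * partialD x α u a * partialD x β u b
        * partialD g c (x u)
      = ∑ a, ∑ b, ∑ c, partialD x α u a * partialD x β u b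
        * (X.christoffel (x u) c a b * partialD g c (x u)) := by
    rw [Finset.sum_comm]
    refine Finset.sum_congr rfl fun a _ => ?_
    rw [Finset.sum_comm]
    exact Finset.sum_congr rfl fun b _ => Finset.sum_congr rfl fun c _ => by ring
  rw [this]
  ring

/-- The trace of the second derivatives of `g ∘ x` at a critical point of `g ∘ x`. -/
theorem trace_partialD_partialD_comp {k : ℕ} {g : (Fin m → ℝ) → ℝ}
    {x : (Fin k → ℝ) → Fin m → ℝ} {u : Fin k → ℝ} (hg : ContDiffAt ℝ 2 g (x u))
    (hx : ContDiffAt ℝ 2 x u) (he : ∀ α, fderiv ℝ g (x u) (frame x u α) = 0) :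
    ∑ α, ∑ β, (X.gram (x u) (frame x u))⁻¹ α β
        * partialD (fun w => partialD (fun w => g (x w)) β w) α u
      = ∑ α, ∑ β, (X.gram (x u) (frame x u))⁻¹ α β
          * X.hessian g (x u) (frame x u α) (frame x u β)
        - fderiv ℝ g (x u) (X.meanCurvature x u) := by
  have : fderiv ℝ g (x u) (X.meanCurvature x u) = - ∑ α, ∑ β,
      (X.gram (x u) (frame x u))⁻¹ α β * fderiv ℝ g (x u) (X.covD x u α β) := by
    simp [meanCurvature, map_sum, X.fderiv_normalPart he]
  rw [this, sub_neg_eq_add, ← Finset.sum_add_distrib]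
  refine Finset.sum_congr rfl fun α _ => ?_
  rw [← Finset.sum_add_distrib]
  refine Finset.sum_congr rfl fun β _ => ?_
  rw [← X.hessian_frame_add_fderiv_covD hg hx, mul_add]

/-- A region with a foliation by `k`-future convex hypersurfaces with future causal normal contains
no `k`-dimensional closed trapped submanifold. -/
theorem FoliatedByFutureConvex.not_subset_of_isCTM {k : ℕ} {g : (Fin m → ℝ) → ℝ}
    {Z : Set (Fin m → ℝ)} (hZ : X.FoliatedByFutureConvex k g Z)
    (hneg : ∀ p ∈ Z, ∀ v, X.FutureTimelike p v → fderiv ℝ g p v < 0)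
    {S : Set (Fin m → ℝ)} (hS : X.IsCTM k S) : ¬ S ⊆ Z := by
  intro hSZ
  obtain ⟨hZo, -, hgZ, hconv⟩ := hZ
  obtain ⟨hne, hcpt, -, hpar⟩ := hS
  obtain ⟨p, hpS, hp⟩ := hcpt.exists_isMaxOn hne (hgZ.continuousOn.mono hSZ)
  obtain ⟨V, x, u, hx, huV, rfl, hgram, hH⟩ := hpar p hpS
  have hg : ContDiffAt ℝ 2 g (x u) := hgZ.contDiffAt (hZo.mem_nhds (hSZ hpS))
  have hxu : ContDiffAt ℝ 2 x u :=
    (hx.contDiffOn.contDiffAt (hx.isOpen.mem_nhds huV)).of_le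
      (WithTop.coe_le_coe.2 (le_top : (2 : ℕ∞) ≤ ⊤))
  have hmax : IsLocalMax (fun w => g (x w)) u := by
    filter_upwards [hx.isOpen.mem_nhds huV] with w hw
    obtain ⟨O, -, hO⟩ := hx.image
    exact hp (hO.le ⟨w, hw, rfl⟩).1
  have hF : ContDiffAt ℝ 2 (fun w => g (x w)) u := hg.comp u hxu
  have he : ∀ α, fderiv ℝ g (x u) (frame x u α) = 0 := by
    intro α
    have h := ((hg.differentiableAt (by norm_num)).hasFDerivAt.comp u
      (hxu.differentiableAt (by norm_num)).hasFDerivAt).fderiv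
    have h0 : fderiv ℝ (g ∘ x) u = 0 := hmax.fderiv_eq_zero
    rw [h0] at h
    exact (DFunLike.congr_fun h (Pi.single α 1)).symm
  -- At the maximum the negated second derivatives form a nonnegative quadratic form, so their trace
  -- against the inverse Gram matrix is nonnegative.
  have h1 := hgram.sum_inv_mul_nonneg
    (N := fun α β => - partialD (fun w => partialD (fun w => g (x w)) β w) α u) fun v => by
      simpa using hmax.sum_partialD_partialD_nonpos hF v
  simp only [mul_neg, Finset.sum_neg_distrib, X.trace_partialD_partialD_comp hg hxu he] at h1
  -- By the trace formula `h1` says that the trace of the Hessian is at most `dg(H)`; convexity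
  -- makes the former nonnegative and `hneg` the latter negative.
  have h2 := (hconv _ (hSZ hpS)).2 (frame x u) he hgram
  have h3 := hneg _ (hSZ hpS) _ hH
  linarith

end CoordSpacetime

/-! ### Cartesian building blocks of the metric -/

/-- Once differentiability is known, every partial derivative below is computed as a one-variable
derivative along a coordinate line. -/
theorem HasLineDerivAt.partialD_eq {m : ℕ} {F : (Fin m → ℝ) → ℝ} {p : Fin m → ℝ} {a : Fin m} {c : ℝ}
    (h : HasLineDerivAt ℝ F c p (Pi.single a 1)) (hF : DifferentiableAt ℝ F p) :
    partialD F a p = c := by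
  rw [partialD, ← hF.lineDeriv_eq_fderiv, h.lineDeriv]

namespace Schwarzschild

/-- The spatial position vector `x = r ∂_r`. -/
def position (p : Fin 4 → ℝ) (a : Fin 4) : ℝ := if a = 0 then 0 else p a

theorem formR_eq (p : Fin 4 → ℝ) (a : Fin 4) : formR p a = position p a / radius p := by
  unfold formR position; split_ifs <;> simp

theorem flat_comm (a b : Fin 4) : flat a b = flat b a := by
  fin_cases a <;> fin_cases b <;> simp [flat]

theorem sum_formT_mul (w : Fin 4 → ℝ) : ∑ a, formT a * w a = w 0 := by
  simp [formT]

theorem sum_position_mul (p w : Fin 4 → ℝ) :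
    ∑ a, position p a * w a = p 1 * w 1 + p 2 * w 2 + p 3 * w 3 := by
  simp [Fin.sum_univ_four, position]

theorem sum_flat_mul (a : Fin 4) (w : Fin 4 → ℝ) :
    ∑ b, flat a b * w b = if a = 0 then 0 else w a := by
  fin_cases a <;> simp [flat]

theorem sum_position_sq (p : Fin 4 → ℝ) : ∑ a, position p a * position p a = radius p ^ 2 := by
  rw [sum_position_mul, radius_sq]; simp [position]; ring

/-- The coordinate lines. -/
theorem hasDerivAt_line (p : Fin 4 → ℝ) (a b : Fin 4) :
    HasDerivAt (fun s : ℝ => (p + s • Pi.single a 1 : Fin 4 → ℝ) b) (if b = a then 1 else 0) 0 := by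
  have := ((hasDerivAt_id (0 : ℝ)).mul_const ((Pi.single a 1 : Fin 4 → ℝ) b)).const_add (p b)
  simpa [Pi.single_apply] using this

theorem hasLineDerivAt_position (p : Fin 4 → ℝ) (a b : Fin 4) :
    HasLineDerivAt ℝ (fun q => position q b) (flat b a) p (Pi.single a 1) := by
  unfold position HasLineDerivAt
  by_cases hb : b = 0
  · simp [hb, flat]
    exact hasDerivAt_const _ _
  · simpa [hb, flat] using hasDerivAt_line p a b

theorem hasLineDerivAt_radius {p : Fin 4 → ℝ} (hp : 0 < radius p) (a : Fin 4) :
    HasLineDerivAt ℝ radius (position p a / radius p) p (Pi.single a 1) := by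
  have h := (((hasDerivAt_line p a 1).pow 2).add ((hasDerivAt_line p a 2).pow 2)).add
    ((hasDerivAt_line p a 3).pow 2)
  have h2 := h.sqrt (by simpa using (Real.sqrt_pos.1 hp).ne')
  refine h2.congr_deriv ?_
  have : radius p ≠ 0 := hp.ne'
  fin_cases a <;> simp [position] <;> rw [← radius] <;> field_simp

theorem hasLineDerivAt_comp_radius {p : Fin 4 → ℝ} (hp : 0 < radius p) (a : Fin 4) {k : ℝ → ℝ}
    {k' : ℝ} (hk : HasDerivAt k k' (radius p)) :
    HasLineDerivAt ℝ (fun q => k (radius q)) (k' * (position p a / radius p)) p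
      (Pi.single a 1) := by
  have h := hasLineDerivAt_radius hp a
  unfold HasLineDerivAt at h ⊢
  refine HasDerivAt.comp (0 : ℝ) (h₂ := k) (h := fun s : ℝ => radius (p + s • Pi.single a 1)) ?_ h
  simpa using hk

theorem _root_.HasLineDerivAt.mul' {F G : (Fin 4 → ℝ) → ℝ} {p v : Fin 4 → ℝ} {c d : ℝ}
    (hF : HasLineDerivAt ℝ F c p v) (hG : HasLineDerivAt ℝ G d p v) :
    HasLineDerivAt ℝ (fun q => F q * G q) (c * G p + F p * d) p v := by
  unfold HasLineDerivAt at *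
  have h := HasDerivAt.mul hF hG
  rw [zero_smul, add_zero] at h
  exact h

theorem _root_.HasLineDerivAt.add' {F G : (Fin 4 → ℝ) → ℝ} {p v : Fin 4 → ℝ} {c d : ℝ}
    (hF : HasLineDerivAt ℝ F c p v) (hG : HasLineDerivAt ℝ G d p v) :
    HasLineDerivAt ℝ (fun q => F q + G q) (c + d) p v := by
  unfold HasLineDerivAt at *
  exact HasDerivAt.add hF hG

/-! ### The Levi-Civita connection -/

/-- The metric is `-f dt² + flat + B xᵢxⱼ`, with this `B`. -/
def radialCoeff (M r : ℝ) : ℝ := 2 * M / (r ^ 2 * (r - 2 * M))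

variable {M : ℝ} {h : ℝ → ℝ} {p : Fin 4 → ℝ} {r θ : ℝ}

theorem metric_eq (hp : p ∈ region M) (a b : Fin 4) :
    metric M p a b = (2 * M / radius p - 1) * (formT a * formT b) + flat a b
      + radialCoeff M (radius p) * (position p a * position p b) := by
  have h1 : radius p ≠ 0 := hp.1.ne'
  have h2 : radius p - 2 * M ≠ 0 := by linarith [hp.2]
  have h3 : (lapse M p)⁻¹ = radius p / (radius p - 2 * M) := by
    unfold lapse; field_simp
  simp only [metric, Matrix.of_apply, h3, formR_eq, radialCoeff]
  unfold lapse
  field_simp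
  ring

theorem isOpen_region (M : ℝ) : IsOpen (region M) := (blackHole M).isOpen_carrier

theorem hasDerivAt_radialCoeff {r : ℝ} (h1 : 0 < r) (h2 : r < 2 * M) :
    HasDerivAt (radialCoeff M) (-(2 * M * (3 * r - 4 * M)) / (r ^ 3 * (r - 2 * M) ^ 2)) r := by
  have h1' := h1.ne'
  have h2' : r - 2 * M ≠ 0 := by linarith
  have := (((hasDerivAt_id r).pow 2).mul ((hasDerivAt_id r).sub_const (2 * M))).fun_inv
    (by simp [h1', h2'])
  refine (this.const_mul (2 * M)).congr_deriv ?_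
  simp
  field_simp
  ring

theorem partialD_metric (hp : p ∈ region M) (a b d : Fin 4) :
    partialD (fun q => metric M q a b) d p =
      -(2 * M / radius p ^ 2) * (position p d / radius p) * (formT a * formT b)
      + (-(2 * M * (3 * radius p - 4 * M)) / (radius p ^ 3 * (radius p - 2 * M) ^ 2))
        * (position p d / radius p) * (position p a * position p b)
      + radialCoeff M (radius p) * (flat a d * position p b + position p a * flat b d) := by
  have hd : DifferentiableAt ℝ (fun q => metric M q a b) p :=
    ((((blackHole M).smooth a b).contDiffAt ((isOpen_region M).mem_nhds hp))).differentiableAt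
      (by simp)
  have hev : (fun q => metric M q a b) =ᶠ[𝓝 p] fun q =>
      (2 * M / radius q - 1) * (formT a * formT b) + flat a b
      + radialCoeff M (radius q) * (position q a * position q b) := by
    filter_upwards [(isOpen_region M).mem_nhds hp] with q hq using metric_eq hq a b
  have h1 : HasDerivAt (fun r => (2 * M / r - 1) * (formT a * formT b) + flat a b)
      (-(2 * M / radius p ^ 2) * (formT a * formT b)) (radius p) := by
    have := (((hasDerivAt_inv hp.1.ne').const_mul (2 * M)).sub_const 1).mul_const
      (formT a * formT b) |>.add_const (flat a b)
    refine this.congr_deriv ?_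
    ring
  have h := (hasLineDerivAt_comp_radius hp.1 d h1).add'
    ((hasLineDerivAt_comp_radius hp.1 d (hasDerivAt_radialCoeff hp.1 hp.2)).mul'
      ((hasLineDerivAt_position p d a).mul' (hasLineDerivAt_position p d b)))
  rw [(h.congr_of_eventuallyEq hev).partialD_eq hd]
  ring

/-- The inverse metric. -/
theorem metric_inv (hp : p ∈ region M) (c d : Fin 4) :
    (metric M p)⁻¹ c d = -(lapse M p)⁻¹ * (formT c * formT d) + flat c d
      - 2 * M / radius p ^ 3 * (position p c * position p d) := by
  have h1 : radius p ≠ 0 := hp.1.ne'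
  have h2 : radius p - 2 * M ≠ 0 := by linarith [hp.2]
  have h3 : (lapse M p)⁻¹ = radius p / (radius p - 2 * M) := by
    unfold lapse; field_simp
  -- The metric multiplies the radial projector by `f⁻¹`, that is, adds `f⁻¹ - 1` times it to the
  -- flat part. The inverse therefore adds `f - 1 = -2M/r` times it, and the projector is `x xᵀ/r²`.
  have key : metric M p * (Matrix.of fun c d : Fin 4 => -(lapse M p)⁻¹ * (formT c * formT d)
      + flat c d - 2 * M / radius p ^ 3 * (position p c * position p d)) = 1 := by
    ext a b
    -- The summand is regrouped so that `j` occurs only in contractions with `formT`, `flat` or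
    -- `position`.
    have e : ∀ j : Fin 4, metric M p a j * ((-(lapse M p)⁻¹ * (formT j * formT b)
      + flat j b - 2 * M / radius p ^ 3 * (position p j * position p b)))
      = ((2 * M / radius p - 1) * formT a) * (formT j * (-(lapse M p)⁻¹ * (formT j * formT b)
          + flat j b - 2 * M / radius p ^ 3 * (position p j * position p b)))
        + flat a j * (-(lapse M p)⁻¹ * (formT j * formT b)
          + flat j b - 2 * M / radius p ^ 3 * (position p j * position p b))
        + radialCoeff M (radius p) * position p a * (-(lapse M p)⁻¹ * formT b *
            (position p j * formT j) + position p j * flat b j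
          - 2 * M / radius p ^ 3 * position p b * (position p j * position p j)) := by
      intro j
      rw [metric_eq hp, flat_comm j b]; ring
    rw [Matrix.mul_apply]
    simp only [Matrix.of_apply, e, Finset.sum_add_distrib, Finset.sum_sub_distrib,
      ← Finset.mul_sum, sum_formT_mul, sum_flat_mul, sum_position_sq]
    simp only [mul_comm (position p _) (formT _), mul_comm (position p _) (flat _ _),
      sum_formT_mul, sum_flat_mul]
    rw [h3, radialCoeff]
    have p0 : position p 0 = 0 := by simp [position]
    have f0 : ∀ b, flat 0 b = 0 := by intro b; simp [flat]
    have t0 : formT 0 = 1 := by simp [formT]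
    have tn : ∀ a, a ≠ 0 → formT a = 0 := by intro a h; simp [formT, h]
    by_cases ha : a = 0
    · subst ha
      by_cases hb : b = 0
      · subst hb
        simp [p0, f0, t0]
        field_simp
        ring
      · simp [p0, f0, t0, tn b hb, hb, Ne.symm hb]
    · by_cases hb : b = 0
      · subst hb
        simp [p0, t0, tn a ha, ha, flat]
      · simp only [p0, f0, t0, tn a ha, tn b hb, ha, hb, if_false]
        rw [flat, Matrix.one_apply]
        by_cases hab : a = b
        · simp [hab, hb]
          field_simp
          ring
        · simp [hab]
          field_simp
          ring
  rw [Matrix.inv_eq_right_inv key]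
  rfl

/-- The nonzero part of `Γ_{d,ab}` along the position vector. -/
def christoffelRadial (M : ℝ) (p : Fin 4 → ℝ) (a b : Fin 4) : ℝ :=
  -(2 * M * (3 * radius p - 4 * M)) / (radius p ^ 3 * (radius p - 2 * M) ^ 2) / (2 * radius p)
      * (position p a * position p b)
    + radialCoeff M (radius p) * flat a b + M / radius p ^ 3 * (formT a * formT b)

/-- The nonzero part of `Γ_{d,ab}` along `dt`. -/
def christoffelTime (M : ℝ) (p : Fin 4 → ℝ) (a b : Fin 4) : ℝ :=
  -(M / radius p ^ 3) * (position p a * formT b + position p b * formT a)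

/-- With the first index lowered the symbol is `x_d` times the radial part plus `(dt)_d` times the
time part. Raising the index multiplies `x` by `f` and `dt` by `-f⁻¹`. -/
theorem christoffel_eq (hp : p ∈ region M) (c a b : Fin 4) :
    (blackHole M).christoffel p c a b =
      lapse M p * position p c * christoffelRadial M p a b
        - (lapse M p)⁻¹ * formT c * christoffelTime M p a b := by
  have h1 : radius p ≠ 0 := hp.1.ne'
  have h2 : radius p - 2 * M ≠ 0 := by linarith [hp.2]
  have e : ∀ d : Fin 4, (metric M p)⁻¹ c d *
    (partialD (fun q => metric M q d b) a p + partialD (fun q => metric M q d a) b p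
      - partialD (fun q => metric M q a b) d p)
    = 2 * (christoffelRadial M p a b * (-(lapse M p)⁻¹ * formT c * (formT d * position p d)
          + flat c d * position p d - 2 * M / radius p ^ 3 * position p c
            * (position p d * position p d))
        + christoffelTime M p a b * (-(lapse M p)⁻¹ * formT c * (formT d * formT d)
          + flat c d * formT d - 2 * M / radius p ^ 3 * position p c
            * (formT d * position p d))) := by
    intro d
    rw [metric_inv hp, partialD_metric hp, partialD_metric hp, partialD_metric hp,
      flat_comm b a, flat_comm a d, flat_comm b d, christoffelRadial, christoffelTime]
    ring
  change 1 / 2 * ∑ d, (metric M p)⁻¹ c d *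
    (partialD (fun q => metric M q d b) a p + partialD (fun q => metric M q d a) b p
      - partialD (fun q => metric M q a b) d p) = _
  simp only [e, ← Finset.mul_sum, Finset.sum_add_distrib, Finset.sum_sub_distrib, sum_formT_mul,
    sum_flat_mul, sum_position_sq]
  have p0 : position p 0 = 0 := by simp [position]
  have e1 : (if c = 0 then 0 else position p c) = position p c := by
    unfold position; split_ifs <;> rfl
  have e2 : (if c = 0 then 0 else formT c) = 0 := by simp [formT]
  have t0 : formT 0 = 1 := by simp [formT]
  rw [p0, e1, e2, t0]
  unfold lapse
  field_simp
  ring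

/-! ### The derivatives of the foliation function -/

/-- The distance from the axis. -/
def axisDist (p : Fin 4 → ℝ) : ℝ := Real.sqrt (p 1 ^ 2 + p 2 ^ 2)

/-- The part of the black hole region off the axis. -/
def offAxis (M : ℝ) : Set (Fin 4 → ℝ) := {p | p ∈ region M ∧ 0 < axisDist p}

theorem continuous_axisDist : Continuous axisDist := by unfold axisDist; fun_prop

theorem isOpen_offAxis (M : ℝ) : IsOpen (offAxis M) :=
  (isOpen_region M).inter (isOpen_lt continuous_const continuous_axisDist)

theorem axisDist_sq (p : Fin 4 → ℝ) : axisDist p ^ 2 = p 1 ^ 2 + p 2 ^ 2 :=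
  Real.sq_sqrt (by positivity)

theorem hasLineDerivAt_axisDist (hp : 0 < axisDist p) (a : Fin 4) :
    HasLineDerivAt ℝ axisDist ((position p a - p 3 * flat a 3) / axisDist p) p
      (Pi.single a 1) := by
  have h := ((hasDerivAt_line p a 1).pow 2).add ((hasDerivAt_line p a 2).pow 2)
  have h2 := h.sqrt (by simpa using (Real.sqrt_pos.1 hp).ne')
  refine h2.congr_deriv ?_
  have : axisDist p ≠ 0 := hp.ne'
  fin_cases a <;> simp [position, flat] <;> rw [← axisDist] <;> field_simp

/-- Off the axis the argument of `arccos` stays away from `±1`, where `arccos` is not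
differentiable. -/
theorem abs_div_radius_lt_one (hr : 0 < radius p) (hp : 0 < axisDist p) :
    |p 3 / radius p| < 1 := by
  rw [abs_div, abs_of_pos hr, div_lt_one hr]
  refine abs_lt_of_sq_lt_sq ?_ hr.le
  have := axisDist_sq p
  have := radius_sq p
  nlinarith

theorem hasLineDerivAt_polarAngle (hr : 0 < radius p) (hp : 0 < axisDist p) (a : Fin 4) :
    HasLineDerivAt ℝ polarAngle ((p 3 * position p a / radius p ^ 2 - flat a 3) / axisDist p) p
      (Pi.single a 1) := by
  have hlt := abs_lt.1 (abs_div_radius_lt_one hr hp)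
  have h1 : HasDerivAt (fun s : ℝ => (p + s • Pi.single a 1 : Fin 4 → ℝ) 3) (flat a 3) 0 := by
    have := hasDerivAt_line p a 3
    refine this.congr_deriv ?_
    fin_cases a <;> simp [flat]
  have h2 := h1.div (hasLineDerivAt_radius hr a) (by simpa using hr.ne')
  have h3 : HasDerivAt Real.arccos (-(1 / Real.sqrt (1 - (p 3 / radius p) ^ 2)))
      (p 3 / radius p) := Real.hasDerivAt_arccos hlt.1.ne' hlt.2.ne
  -- This is `sin θ = ρ/r`, with `ρ` the distance from the axis.
  have h4 : Real.sqrt (1 - (p 3 / radius p) ^ 2) = axisDist p / radius p := by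
    rw [show 1 - (p 3 / radius p) ^ 2 = (axisDist p / radius p) ^ 2 from ?_,
      Real.sqrt_sq (by positivity)]
    have := hr.ne'
    field_simp
    rw [axisDist_sq, radius_sq]; ring
  rw [h4] at h3
  have h5 := HasDerivAt.comp (0 : ℝ) (h₂ := Real.arccos)
    (h := fun s : ℝ => (p + s • Pi.single a 1 : Fin 4 → ℝ) 3 / radius (p + s • Pi.single a 1))
    (by simpa using h3) h2
  refine h5.congr_deriv ?_
  have := hr.ne'
  have := hp.ne'
  simp
  field_simp
  ring

/-- The derivative of the antiderivative `h`. -/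
def profile (M r : ℝ) : ℝ := 1 / Real.sqrt (r * (2 * M - r))

theorem hasDerivAt_profile {r : ℝ} (h1 : 0 < r) (h2 : r < 2 * M) :
    HasDerivAt (profile M) (-(M - r) * profile M r ^ 3) r := by
  have hpos : 0 < r * (2 * M - r) := mul_pos h1 (by linarith)
  have hd := (((hasDerivAt_id r).mul ((hasDerivAt_id r).const_sub (2 * M))).sqrt
    (by simpa using hpos.ne')).fun_inv (by simpa using (Real.sqrt_pos.2 hpos).ne')
  have hs := (Real.sqrt_pos.2 hpos).ne'
  have e : profile M = fun r => (Real.sqrt (r * (2 * M - r)))⁻¹ := by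
    ext r; rw [profile, one_div]
  rw [e]
  refine HasDerivAt.congr_deriv (f := fun r => (Real.sqrt (r * (2 * M - r)))⁻¹) hd ?_
  simp
  field_simp
  ring

theorem contDiffAt_antideriv (hh : ∀ r ∈ Set.Ioo 0 (2 * M), HasDerivAt h (profile M r) r) {r : ℝ}
    (hr : r ∈ Set.Ioo 0 (2 * M)) : ContDiffAt ℝ 2 h r := by
  have hop : IsOpen (Set.Ioo 0 (2 * M)) := isOpen_Ioo
  have h1 : ContDiffOn ℝ 1 (deriv h) (Set.Ioo 0 (2 * M)) := by
    have : ContDiffOn ℝ 1 (profile M) (Set.Ioo 0 (2 * M)) := by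
      intro s hs
      have hpos : 0 < s * (2 * M - s) := mul_pos hs.1 (by linarith [hs.2])
      refine ContDiffAt.contDiffWithinAt ?_
      refine contDiffAt_const.div (ContDiffAt.sqrt (by fun_prop) hpos.ne')
        (Real.sqrt_pos.2 hpos).ne'
    exact this.congr fun s hs => (hh s hs).deriv
  have : ContDiffOn ℝ (1 + 1) h (Set.Ioo 0 (2 * M)) := by
    rw [contDiffOn_succ_iff_deriv_of_isOpen hop]
    exact ⟨fun s hs => (hh s hs).differentiableAt.differentiableWithinAt, by simp, h1⟩
  have h3 := this.contDiffAt (hop.mem_nhds hr)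
  rwa [one_add_one_eq_two] at h3

theorem contDiffAt_foliation (hh : ∀ r ∈ Set.Ioo 0 (2 * M), HasDerivAt h (profile M r) r)
    (hp : p ∈ offAxis M) : ContDiffAt ℝ 2 (foliation h) p := by
  have hr : ContDiffAt ℝ 2 radius p :=
    (contDiffAt_radius hp.1.1).of_le (WithTop.coe_le_coe.2 (le_top : (2 : ℕ∞) ≤ ⊤))
  have hlt := abs_lt.1 (abs_div_radius_lt_one hp.1.1 hp.2)
  have h1 : ContDiffAt ℝ 2 polarAngle p :=
    (Real.contDiffAt_arccos hlt.1.ne' hlt.2.ne).comp p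
      (ContDiffAt.div (f := fun q : Fin 4 → ℝ => q 3) (by fun_prop) hr hp.1.1.ne')
  exact h1.add ((contDiffAt_antideriv hh hp.1).comp p hr)

/-- The components of the differential of the foliation function. -/
def diffFoliation (M : ℝ) (p : Fin 4 → ℝ) (a : Fin 4) : ℝ :=
  (p 3 * position p a / radius p ^ 2 - flat a 3) / axisDist p
    + profile M (radius p) * (position p a / radius p)

theorem partialD_foliation (hh : ∀ r ∈ Set.Ioo 0 (2 * M), HasDerivAt h (profile M r) r)
    (hp : p ∈ offAxis M) (a : Fin 4) : partialD (foliation h) a p = diffFoliation M p a :=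
  ((hasLineDerivAt_polarAngle hp.1.1 hp.2 a).add'
    (hasLineDerivAt_comp_radius hp.1.1 a (hh _ hp.1))).partialD_eq
    ((contDiffAt_foliation hh hp).differentiableAt (by norm_num))

theorem partialD_partialD_foliation
    (hh : ∀ r ∈ Set.Ioo 0 (2 * M), HasDerivAt h (profile M r) r)
    (hp : p ∈ offAxis M) (a b : Fin 4) :
    partialD (fun q => partialD (foliation h) b q) a p =
      (p 3 / (radius p ^ 2 * axisDist p) + profile M (radius p) / radius p) * flat a b
      + (-2 * p 3 / (radius p ^ 4 * axisDist p) - p 3 / (radius p ^ 2 * axisDist p ^ 3)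
          - (M - radius p) * profile M (radius p) ^ 3 / radius p ^ 2
          - profile M (radius p) / radius p ^ 3) * (position p a * position p b)
      + 1 / axisDist p ^ 3 * (flat a 3 * position p b + position p a * flat b 3)
      - p 3 / axisDist p ^ 3 * (flat a 3 * flat b 3) := by
  have hr := hp.1.1
  have hev : (fun q => partialD (foliation h) b q) =ᶠ[𝓝 p] fun q => diffFoliation M q b := by
    filter_upwards [(isOpen_offAxis M).mem_nhds hp] with q hq using partialD_foliation hh hq b
  have hz : HasLineDerivAt ℝ (fun q : Fin 4 → ℝ => q 3) (flat 3 a) p (Pi.single a 1) := by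
    simpa [position] using hasLineDerivAt_position p a 3
  have hi2 : HasDerivAt (fun r : ℝ => (r ^ 2)⁻¹) (-2 / radius p ^ 3) (radius p) := by
    have := ((hasDerivAt_id (radius p)).pow 2).fun_inv (by simpa using hr.ne')
    refine this.congr_deriv ?_
    have := hr.ne'
    simp
    field_simp
  have hi : HasDerivAt (fun r : ℝ => profile M r * r⁻¹)
      (-(M - radius p) * profile M (radius p) ^ 3 * (radius p)⁻¹
        + profile M (radius p) * -(radius p ^ 2)⁻¹) (radius p) :=
    (hasDerivAt_profile hr hp.1.2).mul (hasDerivAt_inv hr.ne')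
  have hρ : HasLineDerivAt ℝ (fun q => (axisDist q)⁻¹)
      (-((position p a - p 3 * flat a 3) / axisDist p) / axisDist p ^ 2) p (Pi.single a 1) := by
    have := HasDerivAt.fun_inv (hasLineDerivAt_axisDist hp.2 a) (by simpa using hp.2.ne')
    unfold HasLineDerivAt
    simpa using this
  have hc : HasLineDerivAt ℝ (fun _ : Fin 4 → ℝ => -flat b 3) 0 p (Pi.single a 1) :=
    hasDerivAt_const _ _
  have hx := hasLineDerivAt_position p a b
  have hd := ((((hz.mul' hx).mul' (hasLineDerivAt_comp_radius hr a hi2)).add' hc).mul' hρ).add'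
    ((hasLineDerivAt_comp_radius hr a hi).mul' hx)
  have hev' : (fun q => partialD (foliation h) b q) =ᶠ[𝓝 p] fun q =>
      (q 3 * position q b * (radius q ^ 2)⁻¹ + -flat b 3) * (axisDist q)⁻¹
        + profile M (radius q) * (radius q)⁻¹ * position q b := by
    refine hev.trans (Eventually.of_forall fun q => ?_)
    simp only [diffFoliation]
    ring
  rw [(hd.congr_of_eventuallyEq hev').partialD_eq
    ((contDiffAt_foliation hh hp).differentiableAt_partialD b), flat_comm b a, flat_comm 3 a]
  have h1 := hr.ne'
  have h2 := hp.2.ne'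
  have h3 : p 3 ^ 2 = radius p ^ 2 - axisDist p ^ 2 := by rw [radius_sq, axisDist_sq]; ring
  field_simp
  linear_combination (radius p ^ 2 * flat a 3 * position p b) * h3

/-- The position vector is `r ∂_r`, and the polar angle is constant along rays, so only the
antiderivative contributes. -/
theorem sum_position_diffFoliation (hp : p ∈ offAxis M) :
    ∑ c, position p c * diffFoliation M p c = radius p * profile M (radius p) := by
  have h1 := hp.1.1.ne'
  have h2 := hp.2.ne'
  have e : ∀ c, position p c * diffFoliation M p c = (p 3 / (radius p ^ 2 * axisDist p)
      + profile M (radius p) / radius p) * (position p c * position p c)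
      - 1 / axisDist p * (flat 3 c * position p c) := by
    intro c
    rw [diffFoliation, flat_comm c 3]; field_simp; ring
  simp only [e, Finset.sum_sub_distrib, ← Finset.mul_sum, sum_position_sq, sum_flat_mul]
  simp [position]
  field_simp
  ring

theorem hessian_foliation (hh : ∀ r ∈ Set.Ioo 0 (2 * M), HasDerivAt h (profile M r) r)
    (hp : p ∈ offAxis M) (v w : Fin 4 → ℝ) :
    (blackHole M).hessian (foliation h) p v w =
      (p 3 / (radius p ^ 2 * axisDist p) + profile M (radius p) / radius p
        - lapse M p * radius p * profile M (radius p) * radialCoeff M (radius p))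
          * (v 1 * w 1 + v 2 * w 2 + v 3 * w 3)
      + (-2 * p 3 / (radius p ^ 4 * axisDist p) - p 3 / (radius p ^ 2 * axisDist p ^ 3)
          - (M - radius p) * profile M (radius p) ^ 3 / radius p ^ 2
          - profile M (radius p) / radius p ^ 3
          + lapse M p * radius p * profile M (radius p) *
            (2 * M * (3 * radius p - 4 * M) / (radius p ^ 3 * (radius p - 2 * M) ^ 2)
              / (2 * radius p)))
          * ((v 1 * p 1 + v 2 * p 2 + v 3 * p 3) * (w 1 * p 1 + w 2 * p 2 + w 3 * p 3))
      + 1 / axisDist p ^ 3 * (v 3 * (w 1 * p 1 + w 2 * p 2 + w 3 * p 3)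
        + (v 1 * p 1 + v 2 * p 2 + v 3 * p 3) * w 3)
      - p 3 / axisDist p ^ 3 * (v 3 * w 3)
      - lapse M p * profile M (radius p) * M / radius p ^ 2 * (v 0 * w 0) := by
  have h1 := hp.1.1.ne'
  -- Since `g` does not depend on `t`, the time part of the Christoffel symbols drops out and the
  -- radial part is paired with `r ∂_r g`.
  have hΓ : ∀ a b, ∑ c, (blackHole M).christoffel p c a b * partialD (foliation h) c p
      = lapse M p * radius p * profile M (radius p) * christoffelRadial M p a b := by
    intro a b
    have e : ∀ c, (blackHole M).christoffel p c a b * partialD (foliation h) c p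
        = lapse M p * christoffelRadial M p a b * (position p c * diffFoliation M p c)
          - (lapse M p)⁻¹ * christoffelTime M p a b * (formT c * diffFoliation M p c) := by
      intro c
      rw [christoffel_eq hp.1, partialD_foliation hh hp]; ring
    simp only [e, Finset.sum_sub_distrib, ← Finset.mul_sum, sum_position_diffFoliation hp,
      sum_formT_mul]
    simp [diffFoliation, position, flat]
    ring
  simp only [CoordSpacetime.hessian, hΓ, partialD_partialD_foliation hh hp, christoffelRadial]
  have key : ∀ A B C D E : ℝ, ∑ a, ∑ b, v a * w b * (A * flat a b
      + B * (position p a * position p b) + C * (flat a 3 * position p b + position p a * flat b 3)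
      - D * (flat a 3 * flat b 3) - E * (formT a * formT b))
      = A * (v 1 * w 1 + v 2 * w 2 + v 3 * w 3)
      + B * ((v 1 * p 1 + v 2 * p 2 + v 3 * p 3) * (w 1 * p 1 + w 2 * p 2 + w 3 * p 3))
      + C * (v 3 * (w 1 * p 1 + w 2 * p 2 + w 3 * p 3)
        + (v 1 * p 1 + v 2 * p 2 + v 3 * p 3) * w 3)
      - D * (v 3 * w 3) - E * (v 0 * w 0) := by
    intro A B C D E
    simp [Fin.sum_univ_four, flat, position, formT]
    ring
  rw [← key]
  refine Finset.sum_congr rfl fun a _ => Finset.sum_congr rfl fun b _ => ?_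
  field_simp
  ring

/-! ### Spherical coordinates -/

/-- The vector with components `a, b, c, d` in spherical coordinates. -/
def sphVec (t r θ φ a b c d : ℝ) : Fin 4 → ℝ :=
  a • dT t r θ φ + b • dR t r θ φ + c • dTheta t r θ φ + d • dPhi t r θ φ

theorem axisDist_sph (hr : 0 < r) (hθ : 0 < Real.sin θ) (t φ : ℝ) :
    axisDist (sph t r θ φ) = r * Real.sin θ := by
  have : (r * Real.sin θ * Real.cos φ) ^ 2 + (r * Real.sin θ * Real.sin φ) ^ 2
      = (r * Real.sin θ) ^ 2 := by
    linear_combination (r ^ 2 * Real.sin θ ^ 2) * Real.sin_sq_add_cos_sq φ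
  simp only [axisDist, sph, Matrix.cons_val_one, Matrix.cons_val, this]
  exact Real.sqrt_sq (by positivity)

theorem sph_mem_offAxis (hr : 0 < r) (hrM : r < 2 * M) (hθ : 0 < Real.sin θ) (t φ : ℝ) :
    sph t r θ φ ∈ offAxis M := by
  refine ⟨⟨?_, ?_⟩, ?_⟩
  · rwa [radius_sph hr.le]
  · rwa [radius_sph hr.le]
  · rw [axisDist_sph hr hθ]; positivity

theorem sphVec_dot_position (t φ a b c d : ℝ) :
    sphVec t r θ φ a b c d 1 * sph t r θ φ 1 + sphVec t r θ φ a b c d 2 * sph t r θ φ 2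
      + sphVec t r θ φ a b c d 3 * sph t r θ φ 3 = b * r := by
  rw [sphVec, dT_eq, dR_eq, dTheta_eq, dPhi_eq]
  simp [sph]
  linear_combination (b * r * Real.sin θ ^ 2 + c * r ^ 2 * Real.sin θ * Real.cos θ)
      * Real.sin_sq_add_cos_sq φ + b * r * Real.sin_sq_add_cos_sq θ

theorem sphVec_dot_sphVec (t φ a b c d a' b' c' d' : ℝ) :
    sphVec t r θ φ a b c d 1 * sphVec t r θ φ a' b' c' d' 1
      + sphVec t r θ φ a b c d 2 * sphVec t r θ φ a' b' c' d' 2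
      + sphVec t r θ φ a b c d 3 * sphVec t r θ φ a' b' c' d' 3
      = b * b' + r ^ 2 * (c * c' + Real.sin θ ^ 2 * (d * d')) := by
  simp only [sphVec, dT_eq, dR_eq, dTheta_eq, dPhi_eq]
  simp
  linear_combination (b * b' * Real.sin θ ^ 2 + r * (b * c' + c * b') * Real.sin θ * Real.cos θ
      + r ^ 2 * c * c' * Real.cos θ ^ 2 + r ^ 2 * d * d' * Real.sin θ ^ 2)
      * Real.sin_sq_add_cos_sq φ + (b * b' + r ^ 2 * c * c') * Real.sin_sq_add_cos_sq θ

theorem sphVec_zero (t φ a b c d : ℝ) : sphVec t r θ φ a b c d 0 = a := by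
  simp [sphVec, dT_eq, dR_eq, dTheta_eq, dPhi_eq]

theorem sphVec_three (t φ a b c d : ℝ) :
    sphVec t r θ φ a b c d 3 = b * Real.cos θ - c * (r * Real.sin θ) := by
  simp [sphVec, dT_eq, dR_eq, dTheta_eq, dPhi_eq]
  ring

/-- The coefficients are the Euclidean components in the orthonormal spherical frame, divided by the
lengths `r` and `r sin θ` of `∂_θ` and `∂_φ`. -/
theorem exists_eq_sphVec (hr : 0 < r) (hθ : 0 < Real.sin θ) (t φ : ℝ) (v : Fin 4 → ℝ) :
    ∃ a b c d, v = sphVec t r θ φ a b c d := by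
  refine ⟨v 0, Real.sin θ * Real.cos φ * v 1 + Real.sin θ * Real.sin φ * v 2 + Real.cos θ * v 3,
    (Real.cos θ * Real.cos φ * v 1 + Real.cos θ * Real.sin φ * v 2 - Real.sin θ * v 3) / r,
    (-(Real.sin φ * v 1) + Real.cos φ * v 2) / (r * Real.sin θ), ?_⟩
  have h1 := hr.ne'
  have h2 := hθ.ne'
  have e1 := Real.sin_sq_add_cos_sq φ
  have e2 := Real.sin_sq_add_cos_sq θ
  ext i
  fin_cases i <;> simp [sphVec, dT_eq, dR_eq, dTheta_eq, dPhi_eq] <;> field_simp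
  · linear_combination (-v 1 * e1
      - (Real.cos φ * (Real.cos φ * v 1 + Real.sin φ * v 2)) * e2)
  · linear_combination (-v 2 * e1
      - (Real.sin φ * (Real.cos φ * v 1 + Real.sin φ * v 2)) * e2)
  · linear_combination (- v 3 * e2)

theorem dPhi_eq_sphVec (t φ : ℝ) : dPhi t r θ φ = sphVec t r θ φ 0 0 0 1 := by simp [sphVec]

theorem timeDir_sph (hr : 0 < r) (t φ : ℝ) :
    (blackHole M).timeDir (sph t r θ φ) = sphVec t r θ φ 0 (-1) 0 0 := by
  have h1 := hr.ne'
  ext i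
  change -formR (sph t r θ φ) i = _
  rw [formR, radius_sph hr.le]
  fin_cases i <;> simp [sphVec, dT_eq, dR_eq, dTheta_eq, dPhi_eq, sph] <;> field_simp

/-- `q = √((2M - r)/r)` as a parameter in place of `M`. -/
theorem exists_slope (hr : 0 < r) (hrM : r < 2 * M) : ∃ q : ℝ, 0 < q ∧ M = r * (1 + q ^ 2) / 2 ∧
    Real.sqrt ((2 * M - r) / r) = q ∧ Real.sqrt (r * (2 * M - r)) = r * q ∧
    profile M r = 1 / (r * q) ∧ 1 - 2 * M / r = -q ^ 2 ∧ 
    (M - r) / Real.sqrt (r * (2 * M - r)) = (q ^ 2 - 1) / (2 * q) := by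
  have hpos : 0 < (2 * M - r) / r := div_pos (by linarith) hr
  set q := Real.sqrt ((2 * M - r) / r) with hq
  have hq0 : 0 < q := Real.sqrt_pos.2 hpos
  have hq2 : q ^ 2 = (2 * M - r) / r := Real.sq_sqrt hpos.le
  have hM : M = r * (1 + q ^ 2) / 2 := by rw [hq2]; field_simp; ring
  have hs : Real.sqrt (r * (2 * M - r)) = r * q := by
    rw [show r * (2 * M - r) = (r * q) ^ 2 by rw [mul_pow, hq2]; field_simp]
    exact Real.sqrt_sq (by positivity)
  refine ⟨q, hq0, hM, rfl, hs, by rw [profile, hs], by rw [hq2]; field_simp; ring, ?_⟩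
  rw [hs]
  have : M - r = r * (q ^ 2 - 1) / 2 := by rw [hM]; ring
  rw [this]
  field_simp

theorem fderiv_foliation_sphVec (hh : ∀ r ∈ Set.Ioo 0 (2 * M), HasDerivAt h (profile M r) r)
    (hr : 0 < r) (hrM : r < 2 * M) (hθ : 0 < Real.sin θ) (t φ a b c d : ℝ) :
    fderiv ℝ (foliation h) (sph t r θ φ) (sphVec t r θ φ a b c d) = c + profile M r * b := by
  have hp := sph_mem_offAxis hr hrM hθ t φ
  have h1 := hr.ne'
  have h2 := hθ.ne'
  have h3 := sphVec_dot_position (r := r) (θ := θ) t φ a b c d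
  have e : ∀ i, sphVec t r θ φ a b c d i * diffFoliation M (sph t r θ φ) i
      = (Real.cos θ / (r ^ 2 * Real.sin θ) + profile M r / r)
          * (position (sph t r θ φ) i * sphVec t r θ φ a b c d i)
        - 1 / (r * Real.sin θ) * (flat 3 i * sphVec t r θ φ a b c d i) := by
    intro i
    rw [diffFoliation, radius_sph hr.le, axisDist_sph hr hθ, flat_comm i 3,
      show sph t r θ φ 3 = r * Real.cos θ from rfl]
    field_simp
    ring
  rw [partialD_apply_sum]
  simp only [smul_eq_mul, partialD_foliation hh hp, e, Finset.sum_sub_distrib, ← Finset.mul_sum,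
    sum_position_mul, sum_flat_mul]
  rw [if_neg (by decide),
    show sph t r θ φ 1 * sphVec t r θ φ a b c d 1 + sph t r θ φ 2 * sphVec t r θ φ a b c d 2
    + sph t r θ φ 3 * sphVec t r θ φ a b c d 3 = b * r by rw [← h3]; ring, sphVec_three]
  field_simp
  ring

/-- The central computation. The choice `c = -(profile M r * b)` expresses tangency to the level
set. The parameter `b` disappears because it measures the component along the null generator `∇g`,
and `∇_N N = ½ ∇⟨N, N⟩ = 0` for a gradient `N` that is null throughout a neighbourhood. Using `q`
instead of `M` makes all coefficients rational. -/
theorem hessian_foliation_sphVec (hh : ∀ r ∈ Set.Ioo 0 (2 * M), HasDerivAt h (profile M r) r)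
    (hr : 0 < r) (hrM : r < 2 * M) (hθ : 0 < Real.sin θ) {q : ℝ} (hq : 0 < q)
    (hM : M = r * (1 + q ^ 2) / 2) (hk : profile M r = 1 / (r * q)) (t φ a b d a' b' d' : ℝ) :
    (blackHole M).hessian (foliation h) (sph t r θ φ) (sphVec t r θ φ a b (-(profile M r * b)) d)
        (sphVec t r θ φ a' b' (-(profile M r * b')) d')
      = (1 + q ^ 2) * q / (2 * r ^ 2) * (a * a')
        + Real.sin θ ^ 2 * (Real.cot θ - q) * (d * d') := by
  have h1 := hr.ne'
  have h2 := hθ.ne'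
  have h3 := hq.ne'
  have e2 := Real.sin_sq_add_cos_sq θ
  have hf : lapse M (sph t r θ φ) = -q ^ 2 := by
    rw [lapse, radius_sph hr.le, hM]; field_simp; ring
  rw [hessian_foliation hh (sph_mem_offAxis hr hrM hθ t φ), sphVec_dot_sphVec,
    sphVec_dot_position, sphVec_dot_position, sphVec_zero, sphVec_zero, sphVec_three,
    sphVec_three, hf, axisDist_sph hr hθ, radius_sph hr.le, radialCoeff,
    show sph t r θ φ 3 = r * Real.cos θ from rfl, hk, Real.cot_eq_cos_div_sin]
  have h5 : r - 2 * M = -(r * q ^ 2) := by rw [hM]; ring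
  rw [h5, hM]
  field_simp
  linear_combination (-4 * b * b' * q ^ 3 * Real.cos θ - 8 * b * b' * q ^ 2 * Real.sin θ) * e2

theorem inner_sphVec (hr : 0 < r) {q : ℝ} (hq : 0 < q) (hM : M = r * (1 + q ^ 2) / 2)
    (t φ a b c d a' b' c' d' : ℝ) :
    (blackHole M).inner (sph t r θ φ) (sphVec t r θ φ a b c d) (sphVec t r θ φ a' b' c' d')
      = q ^ 2 * (a * a') - b * b' / q ^ 2 + r ^ 2 * (c * c' + Real.sin θ ^ 2 * (d * d')) := by
  have h1 := hr.ne'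
  have h2 := hq.ne'
  have hf : 1 - 2 * M / r = -q ^ 2 := by rw [hM]; field_simp; ring
  unfold sphVec
  rw [inner_sph M hr, hf]
  field_simp
  ring

/-! ### The gradient -/

theorem gradient_foliation (hh : ∀ r ∈ Set.Ioo 0 (2 * M), HasDerivAt h (profile M r) r)
    (hr : 0 < r) (hrM : r < 2 * M) (hθ : 0 < Real.sin θ) (t φ : ℝ) :
    (blackHole M).gradient (foliation h) (sph t r θ φ)
      = sphVec t r θ φ 0 (profile M r * (r - 2 * M) / r) (1 / r ^ 2) 0 := by
  have hp := sph_mem_offAxis hr hrM hθ t φ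
  have h1 := hr.ne'
  have h2 := hθ.ne'
  have e2 := Real.sin_sq_add_cos_sq θ
  ext c
  have e : ∀ d, (metric M (sph t r θ φ))⁻¹ c d * partialD (foliation h) d (sph t r θ φ)
      = -(lapse M (sph t r θ φ))⁻¹ * formT c * (formT d * diffFoliation M (sph t r θ φ) d)
        + flat c d * diffFoliation M (sph t r θ φ) d - 2 * M / r ^ 3 * position (sph t r θ φ) c
          * (position (sph t r θ φ) d * diffFoliation M (sph t r θ φ) d) := by
    intro d
    rw [metric_inv hp.1, partialD_foliation hh hp, radius_sph hr.le]; ring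
  change ∑ d, (metric M (sph t r θ φ))⁻¹ c d * partialD (foliation h) d (sph t r θ φ) = _
  simp only [e, Finset.sum_add_distrib, Finset.sum_sub_distrib, ← Finset.mul_sum, sum_formT_mul,
    sum_flat_mul, sum_position_diffFoliation hp]
  simp only [diffFoliation, radius_sph hr.le, axisDist_sph hr hθ]
  fin_cases c <;>
    simp [formT, position, flat, sphVec, dT_eq, dR_eq, dTheta_eq, dPhi_eq, sph] <;>
    field_simp
  · ring
  · ring
  · linear_combination e2

theorem futureNull_gradient_foliation
    (hh : ∀ r ∈ Set.Ioo 0 (2 * M), HasDerivAt h (profile M r) r)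
    (hr : 0 < r) (hrM : r < 2 * M) (hθ : 0 < Real.sin θ) (t φ : ℝ) :
    (blackHole M).FutureNull (sph t r θ φ)
      ((blackHole M).gradient (foliation h) (sph t r θ φ)) := by
  obtain ⟨q, hq, hM, -, -, hk, -, -⟩ := exists_slope hr hrM
  have h1 := hr.ne'
  have h2 := hq.ne'
  have hb : profile M r * (r - 2 * M) / r = -q / r := by
    rw [hk, hM]; field_simp; ring
  have hnull : (blackHole M).inner (sph t r θ φ) (sphVec t r θ φ 0 (-q / r) (1 / r ^ 2) 0)
      (sphVec t r θ φ 0 (-q / r) (1 / r ^ 2) 0) = 0 := by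
    rw [inner_sphVec hr hq hM]; field_simp; ring
  have hneg : (blackHole M).inner (sph t r θ φ) (sphVec t r θ φ 0 (-q / r) (1 / r ^ 2) 0)
      ((blackHole M).timeDir (sph t r θ φ)) < 0 := by
    rw [timeDir_sph hr, inner_sphVec hr hq hM]
    have : 0 < q / r / q ^ 2 := by positivity
    have e : q ^ 2 * (0 * 0) - -q / r * -1 / q ^ 2 + r ^ 2 * (1 / r ^ 2 * 0
      + Real.sin θ ^ 2 * (0 * 0)) = - (q / r / q ^ 2) := by ring
    rw [e]; linarith
  rw [gradient_foliation hh hr hrM hθ, hb]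
  refine ⟨⟨?_, hnull.le, hneg⟩, hnull⟩
  intro h0
  rw [h0] at hneg
  simp [CoordSpacetime.inner] at hneg

/-- `dg(v)` is the inner product of `v` with the future null gradient. Concretely, a future timelike
vector has `b < 0` and `r|c| < |b|/q`, and `dg(v) = (rc + b/q)/r`. -/
theorem fderiv_foliation_neg (hh : ∀ r ∈ Set.Ioo 0 (2 * M), HasDerivAt h (profile M r) r)
    (hr : 0 < r) (hrM : r < 2 * M) (hθ : 0 < Real.sin θ) (t φ : ℝ) {v : Fin 4 → ℝ}
    (hv : (blackHole M).FutureTimelike (sph t r θ φ) v) :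
    fderiv ℝ (foliation h) (sph t r θ φ) v < 0 := by
  obtain ⟨q, hq, hM, -, -, hk, -, -⟩ := exists_slope hr hrM
  obtain ⟨a, b, c, d, rfl⟩ := exists_eq_sphVec hr hθ t φ v
  obtain ⟨⟨-, -, h1⟩, h2⟩ := hv
  rw [timeDir_sph hr, inner_sphVec hr hq hM] at h1
  rw [inner_sphVec hr hq hM] at h2
  rw [fderiv_foliation_sphVec hh hr hrM hθ, hk]
  have hb : b / q ^ 2 < 0 := by ring_nf at h1 ⊢; exact h1
  have hb' : b < 0 := by
    by_contra! hb0
    exact absurd hb (not_lt.2 (by positivity))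
  have e : b * b / q ^ 2 = (b / q) ^ 2 := by ring
  rw [e] at h2
  have h3 : (r * c) ^ 2 < (b / q) ^ 2 := by
    have : 0 ≤ q ^ 2 * (a * a) := by nlinarith [sq_nonneg (q * a)]
    have : 0 ≤ r ^ 2 * (Real.sin θ ^ 2 * (d * d)) := by
      nlinarith [sq_nonneg (r * Real.sin θ * d)]
    nlinarith
  have hbq : b / q < 0 := div_neg_of_neg_of_pos hb' hq
  have h4 : r * c < -(b / q) := by
    refine lt_of_le_of_lt (le_abs_self _) ?_
    rw [← abs_of_neg hbq]
    exact sq_lt_sq.1 h3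
  have h5 : c + 1 / (r * q) * b = (r * c + b / q) / r := by field_simp
  rw [h5]
  exact div_neg_of_neg_of_pos (by linarith) hr

/-! ### Convexity of the level sets -/

theorem hessian_nonneg_iff (hh : ∀ r ∈ Set.Ioo 0 (2 * M), HasDerivAt h (profile M r) r)
    (hr : 0 < r) (hrM : r < 2 * M) (hθ : 0 < Real.sin θ) (t φ : ℝ) :
    (∀ v, fderiv ℝ (foliation h) (sph t r θ φ) v = 0 →
      0 ≤ (blackHole M).hessian (foliation h) (sph t r θ φ) v v)
      ↔ Real.sqrt ((2 * M - r) / r) ≤ Real.cot θ := by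
  obtain ⟨q, hq, hM, hs, -, hk, -, -⟩ := exists_slope hr hrM
  rw [hs]
  constructor
  · intro H
    -- The test vector is `∂_φ`, the only direction in which the Hessian can be negative. Its zero
    -- `θ`-component is kept in the shape `-(profile M r * 0)` so that the Hessian formula rewrites.
    have h0 := H (sphVec t r θ φ 0 0 (-(profile M r * 0)) 1)
      (by rw [fderiv_foliation_sphVec hh hr hrM hθ]; ring)
    rw [hessian_foliation_sphVec hh hr hrM hθ hq hM hk] at h0
    have h1 : 0 ≤ Real.sin θ ^ 2 * (Real.cot θ - q) := by linarith
    have := nonneg_of_mul_nonneg_right h1 (by positivity)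
    linarith
  · intro H v hv
    obtain ⟨a, b, c, d, rfl⟩ := exists_eq_sphVec hr hθ t φ v
    rw [fderiv_foliation_sphVec hh hr hrM hθ] at hv
    obtain rfl : c = -(profile M r * b) := by linarith
    rw [hessian_foliation_sphVec hh hr hrM hθ hq hM hk]
    have := sub_nonneg.2 H
    have := mul_self_nonneg a
    have := mul_self_nonneg d
    positivity

/-- On a spacelike line the trace is the Hessian divided by a positive number. Null tangent vectors,
which semi-definiteness also tests, add no condition, and the critical direction `∂_φ` is spacelike.
-/
theorem levelSetFutureConvexAt_one_iff
    (hh : ∀ r ∈ Set.Ioo 0 (2 * M), HasDerivAt h (profile M r) r)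
    (hr : 0 < r) (hrM : r < 2 * M) (hθ : 0 < Real.sin θ) (t φ : ℝ) :
    (blackHole M).LevelSetFutureConvexAt 1 (foliation h) (sph t r θ φ)
      ↔ Real.sqrt ((2 * M - r) / r) ≤ Real.cot θ := by
  have htr : ∀ e : Fin 1 → Fin 4 → ℝ, ((blackHole M).gram (sph t r θ φ) e)⁻¹ 0 0
      = ((blackHole M).inner (sph t r θ φ) (e 0) (e 0))⁻¹ := by
    intro e
    simp [CoordSpacetime.gram]
  constructor
  · intro H
    obtain ⟨q, hq, hM, hs, -, hk, -, -⟩ := exists_slope hr hrM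
    have hin := inner_sphVec (θ := θ) hr hq hM t φ 0 0 (-(profile M r * 0)) 1 0 0
      (-(profile M r * 0)) 1
    have hpos : 0 < (blackHole M).inner (sph t r θ φ) (sphVec t r θ φ 0 0 (-(profile M r * 0)) 1)
        (sphVec t r θ φ 0 0 (-(profile M r * 0)) 1) := by
      rw [hin]; simp; positivity
    have h0 := H (fun _ => sphVec t r θ φ 0 0 (-(profile M r * 0)) 1)
      (fun _ => by rw [fderiv_foliation_sphVec hh hr hrM hθ]; ring) ?_
    · simp only [Finset.univ_unique, Fin.default_eq_zero, Finset.sum_singleton, htr,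
        hessian_foliation_sphVec hh hr hrM hθ hq hM hk] at h0
      have h1 := nonneg_of_mul_nonneg_right h0 (inv_pos.2 hpos)
      have h2 : 0 ≤ Real.sin θ ^ 2 * (Real.cot θ - q) := by linarith
      have := nonneg_of_mul_nonneg_right h2 (by positivity)
      rw [hs]; linarith
    · have : (blackHole M).gram (sph t r θ φ)
          (fun _ : Fin 1 => sphVec t r θ φ 0 0 (-(profile M r * 0)) 1)
          = Matrix.diagonal fun _ => (blackHole M).inner (sph t r θ φ)
            (sphVec t r θ φ 0 0 (-(profile M r * 0)) 1)
            (sphVec t r θ φ 0 0 (-(profile M r * 0)) 1) := by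
        ext i j
        rw [Subsingleton.elim i j]
        simp [CoordSpacetime.gram]
      rw [this]
      exact Matrix.PosDef.diagonal fun _ => hpos
  · intro H e he hg
    have hpos : 0 < (blackHole M).inner (sph t r θ φ) (e 0) (e 0) := hg.diag_pos
    simp only [Finset.univ_unique, Fin.default_eq_zero, Finset.sum_singleton, htr]
    exact mul_nonneg (inv_pos.2 hpos).le
      ((hessian_nonneg_iff hh hr hrM hθ t φ).2 H _ (he 0))

theorem levelSetFutureConvexAt_two_iff
    (hh : ∀ r ∈ Set.Ioo 0 (2 * M), HasDerivAt h (profile M r) r)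
    (hr : 0 < r) (hrM : r < 2 * M) (hθ : 0 < Real.sin θ) (t φ : ℝ) :
    (blackHole M).LevelSetFutureConvexAt 2 (foliation h) (sph t r θ φ)
      ↔ (M - r) / Real.sqrt (r * (2 * M - r)) ≤ Real.cot θ := by
  obtain ⟨q, hq, hM, -, -, hk, -, hs⟩ := exists_slope hr hrM
  have h1 := hr.ne'
  have h2 := hq.ne'
  have h3 := hθ.ne'
  -- The trace is the same for all spacelike planes: metric and Hessian only see the `(a,
  -- d)`-components, and these map each such plane isomorphically onto `ℝ²`. The value is `(1 +
  -- q²)/(2qr²) + (cot θ - q)/r²`.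
  have htr : ∀ e : Fin 2 → Fin 4 → ℝ, (∀ α, fderiv ℝ (foliation h) (sph t r θ φ) (e α) = 0) →
      ((blackHole M).gram (sph t r θ φ) e).PosDef →
      ∑ α, ∑ β, ((blackHole M).gram (sph t r θ φ) e)⁻¹ α β
        * (blackHole M).hessian (foliation h) (sph t r θ φ) (e α) (e β)
      = (Real.cot θ - (q ^ 2 - 1) / (2 * q)) / r ^ 2 := by
    intro e he hg
    have hex : ∀ α, ∃ a b d, e α = sphVec t r θ φ a b (-(profile M r * b)) d := by
      intro α
      obtain ⟨a, b, c, d, hc⟩ := exists_eq_sphVec hr hθ t φ (e α)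
      have := he α
      rw [hc, fderiv_foliation_sphVec hh hr hrM hθ] at this
      obtain rfl : c = -(profile M r * b) := by linarith
      exact ⟨a, b, d, hc⟩
    choose a b d habd using hex
    have hin : ∀ α β, (blackHole M).inner (sph t r θ φ) (e α) (e β)
        = q ^ 2 * (a α * a β) + r ^ 2 * Real.sin θ ^ 2 * (d α * d β) := by
      intro α β
      rw [habd α, habd β, inner_sphVec hr hq hM, hk]
      field_simp
      ring
    have hdet := hg.det_pos.ne'
    have hD : ((blackHole M).gram (sph t r θ φ) e).det
        = q ^ 2 * (r ^ 2 * Real.sin θ ^ 2) * (a 0 * d 1 - a 1 * d 0) ^ 2 := by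
      rw [Matrix.det_fin_two]
      simp only [CoordSpacetime.gram, Matrix.of_apply, hin]
      ring
    -- A nondegenerate Gram matrix means that the `(a, d)`-components of the two vectors are
    -- independent.
    have hne : a 0 * d 1 - a 1 * d 0 ≠ 0 := by
      intro h0
      exact hdet (by rw [hD, h0]; ring)
    have hhess : ∀ α β, (blackHole M).hessian (foliation h) (sph t r θ φ) (e α) (e β)
        = (1 + q ^ 2) * q / (2 * r ^ 2) * (a α * a β)
        + Real.sin θ ^ 2 * (Real.cot θ - q) * (d α * d β) := by
      intro α β
      rw [habd α, habd β, hessian_foliation_sphVec hh hr hrM hθ hq hM hk]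
    have hA : ∀ α β, (blackHole M).gram (sph t r θ φ) e α β
        = q ^ 2 * (a α * a β) + r ^ 2 * Real.sin θ ^ 2 * (d α * d β) := hin
    simp only [Matrix.inv_def, hD, Matrix.adjugate_fin_two, Fin.sum_univ_two, hhess,
      Matrix.of_apply, hA, Ring.inverse_eq_inv', Matrix.smul_apply,
      smul_eq_mul, Matrix.cons_val_zero, Matrix.cons_val_one]
    field_simp
    ring
  have hiff : 0 ≤ (Real.cot θ - (q ^ 2 - 1) / (2 * q)) / r ^ 2
      ↔ (M - r) / Real.sqrt (r * (2 * M - r)) ≤ Real.cot θ := by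
    rw [hs, le_div_iff₀ (by positivity), zero_mul, sub_nonneg]
  rw [← hiff]
  constructor
  · intro H
    -- As the trace does not depend on the plane, the span of `∂_t` and `∂_φ` serves as witness.
    set e : Fin 2 → Fin 4 → ℝ := ![sphVec t r θ φ 1 0 (-(profile M r * 0)) 0,
      sphVec t r θ φ 0 0 (-(profile M r * 0)) 1] with he
    have hker : ∀ α, fderiv ℝ (foliation h) (sph t r θ φ) (e α) = 0 := by
      intro α
      fin_cases α <;> simp only [he] <;>
        simp [-neg_zero, -mul_zero, fderiv_foliation_sphVec hh hr hrM hθ]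
    have hg : ((blackHole M).gram (sph t r θ φ) e).PosDef := by
      have : (blackHole M).gram (sph t r θ φ) e
          = Matrix.diagonal ![q ^ 2, r ^ 2 * Real.sin θ ^ 2] := by
        ext i j
        fin_cases i <;> fin_cases j <;>
          simp [CoordSpacetime.gram, he, inner_sphVec hr hq hM]
      rw [this]
      refine Matrix.PosDef.diagonal fun i => ?_
      fin_cases i <;> simp <;> positivity
    rw [← htr e hker hg]
    exact H e hker hg
  · intro H e he hg
    rw [htr e he hg]
    exact H

/-! ### Spherical coordinates of points, the axis, and the cotangent regions -/

/-- The azimuth is the argument of `p 1 + i p 2`. Points of the axis are included: there the modulus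
vanishes and the value of the argument is irrelevant. -/
theorem exists_eq_sph {p : Fin 4 → ℝ} (hp : 0 < radius p) :
    ∃ t θ φ, 0 ≤ θ ∧ θ ≤ Real.pi ∧ p = sph t (radius p) θ φ := by
  set r := radius p with hr
  have hr2 : r ^ 2 = p 1 ^ 2 + p 2 ^ 2 + p 3 ^ 2 := radius_sq p
  have hle : |p 3 / r| ≤ 1 := by
    rw [abs_div, abs_of_pos hp, div_le_one hp]
    exact abs_le_of_sq_le_sq (by nlinarith [sq_nonneg (p 1), sq_nonneg (p 2)]) hp.le
  have hle' := abs_le.1 hle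
  have hcos : r * Real.cos (Real.arccos (p 3 / r)) = p 3 := by
    rw [Real.cos_arccos hle'.1 hle'.2]; field_simp
  have hsin : r * Real.sin (Real.arccos (p 3 / r)) = ‖(⟨p 1, p 2⟩ : ℂ)‖ := by
    rw [Real.sin_arccos, Complex.norm_def, Complex.normSq_mk,
      show p 1 * p 1 + p 2 * p 2 = r ^ 2 * (1 - (p 3 / r) ^ 2) from ?_,
      Real.sqrt_mul (sq_nonneg r), Real.sqrt_sq hp.le]
    field_simp
    linarith
  refine ⟨p 0, Real.arccos (p 3 / r), Complex.arg ⟨p 1, p 2⟩, Real.arccos_nonneg _,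
    Real.arccos_le_pi _, ?_⟩
  ext i
  fin_cases i
  · rfl
  · simp only [sph]
    rw [hsin]
    exact (Complex.norm_mul_cos_arg ⟨p 1, p 2⟩).symm
  · simp only [sph]
    rw [hsin]
    exact (Complex.norm_mul_sin_arg ⟨p 1, p 2⟩).symm
  · exact hcos.symm

theorem continuous_sph_theta (t r φ : ℝ) : Continuous fun θ => sph t r θ φ := by
  unfold sph
  fun_prop

theorem polarAngle_sph_abs {r s : ℝ} (hr : 0 < r) (hs : |s| ≤ Real.pi) (t φ : ℝ) :
    polarAngle (sph t r s φ) = |s| := by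
  rw [polarAngle, radius_sph hr.le]
  simp only [sph, Matrix.cons_val, mul_div_cancel_left₀ _ hr.ne']
  rw [← Real.cos_abs, Real.arccos_cos (abs_nonneg s) hs]

theorem polarAngle_sph_pi_add {r s : ℝ} (hr : 0 < r) (hs : |s| ≤ Real.pi) (t φ : ℝ) :
    polarAngle (sph t r (Real.pi + s) φ) = Real.pi - |s| := by
  rw [polarAngle, radius_sph hr.le]
  simp only [sph, Matrix.cons_val, mul_div_cancel_left₀ _ hr.ne']
  rw [add_comm, Real.cos_add_pi, Real.arccos_neg, ← Real.cos_abs,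
    Real.arccos_cos (abs_nonneg s) hs]

/-- The polar angle is not differentiable on the axis. -/
theorem not_differentiableAt_foliation_axis {r θ : ℝ} (hr : 0 < r) (hθ : θ = 0 ∨ θ = Real.pi)
    (t φ : ℝ) : ¬ DifferentiableAt ℝ (foliation h) (sph t r θ φ) := by
  intro hd
  -- Along a meridian crossing the axis the polar angle is `|s|` or `π - |s|` while the radius is
  -- constant, so differentiability of `g` would give that of `|s|` at zero.
  have hline : DifferentiableAt ℝ (fun s => sph t r (θ + s) φ) 0 := by
    rw [differentiableAt_pi]
    intro i
    fin_cases i <;> simp [sph] <;> fun_prop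
  have hd' : DifferentiableAt ℝ (foliation h) (sph t r (θ + 0) φ) := by rwa [add_zero]
  have hc : DifferentiableAt ℝ (fun s => foliation h (sph t r (θ + s) φ)) 0 :=
    DifferentiableAt.comp (0 : ℝ) (f := fun s => sph t r (θ + s) φ) hd' hline
  have hnear : ∀ᶠ s : ℝ in 𝓝 0, |s| ≤ Real.pi := by
    filter_upwards [Metric.ball_mem_nhds (0 : ℝ) Real.pi_pos] with s hs
    rw [Metric.mem_ball, dist_zero_right, Real.norm_eq_abs] at hs
    exact hs.le
  apply not_differentiableAt_abs_zero
  rcases hθ with rfl | rfl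
  · refine (hc.sub_const (h r)).congr_of_eventuallyEq ?_
    filter_upwards [hnear] with s hs
    rw [foliation, radius_sph hr.le, zero_add, polarAngle_sph_abs hr hs]
    ring
  · refine (hc.const_sub (Real.pi + h r)).congr_of_eventuallyEq ?_
    filter_upwards [hnear] with s hs
    rw [foliation, radius_sph hr.le, polarAngle_sph_pi_add hr hs]
    ring

theorem cot_lt_cot {a b : ℝ} (ha : 0 < a) (hab : a < b) (hb : b < Real.pi) :
    Real.cot b < Real.cot a := by
  have h1 : 0 < Real.sin a := Real.sin_pos_of_pos_of_lt_pi ha (hab.trans hb)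
  have h2 : 0 < Real.sin b := Real.sin_pos_of_pos_of_lt_pi (ha.trans hab) hb
  have h3 : 0 < Real.sin (b - a) := Real.sin_pos_of_pos_of_lt_pi (by linarith) (by linarith)
  rw [Real.cot_eq_cos_div_sin, Real.cot_eq_cos_div_sin, div_lt_div_iff₀ h2 h1]
  rw [Real.sin_sub] at h3
  linarith

theorem sph_mem_cotRegion_iff {F : ℝ → ℝ} {t r θ φ : ℝ} (hr : 0 < r) (hrM : r < 2 * M)
    (h0 : 0 < θ) (h1 : θ < Real.pi) :
    sph t r θ φ ∈ cotRegion M F ↔ F r < Real.cot θ := by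
  constructor
  · rintro ⟨t', r', θ', φ', he, hr', -, h0', h1', hF⟩
    have e1 : r = r' := by
      have := congrArg radius he
      rwa [radius_sph hr.le, radius_sph hr'.le] at this
    have e2 : θ = θ' := by
      have := congrArg polarAngle he
      rwa [polarAngle_sph hr h0.le h1.le, polarAngle_sph hr' h0'.le h1'.le] at this
    rwa [e1, e2]
  · exact fun hF => ⟨t, r, θ, φ, rfl, hr, hrM, h0, h1, hF⟩

/-- Expressing `cot θ` as `p 3 / axisDist p` describes the region by continuous functions off the
axis, from which openness follows. -/
theorem cotRegion_eq (F : ℝ → ℝ) :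
    cotRegion M F = {p ∈ offAxis M | F (radius p) < p 3 / axisDist p} := by
  have key : ∀ t r θ φ, 0 < r → 0 < Real.sin θ →
      sph t r θ φ 3 / axisDist (sph t r θ φ) = Real.cot θ := by
    intro t r θ φ hr hs
    rw [axisDist_sph hr hs, Real.cot_eq_cos_div_sin, show sph t r θ φ 3 = r * Real.cos θ from rfl,
      mul_div_mul_left _ _ hr.ne']
  ext p
  constructor
  · rintro ⟨t, r, θ, φ, rfl, hr, hrM, h0, h1, hF⟩
    have hs := Real.sin_pos_of_pos_of_lt_pi h0 h1
    refine ⟨sph_mem_offAxis hr hrM hs t φ, ?_⟩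
    rwa [key _ _ _ _ hr hs, radius_sph hr.le]
  · rintro ⟨⟨⟨hr, hrM⟩, ha⟩, hF⟩
    obtain ⟨t, θ, φ, h0, h1, hp⟩ := exists_eq_sph hr
    have hs : 0 < Real.sin θ := by
      refine lt_of_le_of_ne (Real.sin_nonneg_of_nonneg_of_le_pi h0 h1) fun hs => ?_
      rw [hp] at ha
      simp [axisDist, sph, ← hs] at ha
    have h0' : 0 < θ := lt_of_le_of_ne h0 (by rintro rfl; simp at hs)
    have h1' : θ < Real.pi := lt_of_le_of_ne h1 (by rintro rfl; simp at hs)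
    have hk := key t (radius p) θ φ hr hs
    rw [← hp] at hk
    rw [hk] at hF
    exact ⟨t, radius p, θ, φ, hp, hr, hrM, h0', h1', hF⟩

theorem isOpen_cotRegion {F : ℝ → ℝ} (hF : ContinuousOn F (Set.Ioo 0 (2 * M))) :
    IsOpen (cotRegion M F) := by
  rw [cotRegion_eq]
  have h1 : ContinuousOn (fun p => F (radius p)) (offAxis M) :=
    hF.comp continuous_radius.continuousOn fun p hp => hp.1
  have h2 : ContinuousOn (fun p : Fin 4 → ℝ => p 3 / axisDist p) (offAxis M) :=
    (continuous_apply 3).continuousOn.div continuous_axisDist.continuousOn fun p hp => hp.2.ne'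
  have := (h2.sub h1).isOpen_inter_preimage (isOpen_offAxis M) isOpen_Ioi (t := Set.Ioi 0)
  convert this using 1
  ext p
  simp

/-! ### Determination of the maximal sets -/

/-- The open sets on which `g` is `C²` with future causal gradient and a property `P` holds. -/
def IsAdmissible (M : ℝ) (h : ℝ → ℝ) (P : (Fin 4 → ℝ) → Prop) (Z : Set (Fin 4 → ℝ)) : Prop :=
  IsOpen Z ∧ Z ⊆ (blackHole M).carrier ∧ ContDiffOn ℝ 2 (foliation h) Z ∧
    ∀ p ∈ Z, (blackHole M).FutureCausal p ((blackHole M).gradient (foliation h) p) ∧ P p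

variable {F : ℝ → ℝ} {P : (Fin 4 → ℝ) → Prop}

theorem isAdmissible_cotRegion (hh : ∀ r ∈ Set.Ioo 0 (2 * M), HasDerivAt h (profile M r) r)
    (hF : ContinuousOn F (Set.Ioo 0 (2 * M)))
    (hP : ∀ t r θ φ, 0 < r → r < 2 * M → 0 < Real.sin θ →
      (P (sph t r θ φ) ↔ F r ≤ Real.cot θ)) :
    IsAdmissible M h P (cotRegion M F) := by
  have hoff : cotRegion M F ⊆ offAxis M := by
    rw [cotRegion_eq]; exact Set.sep_subset _ _
  refine ⟨isOpen_cotRegion hF, fun p hp => (hoff hp).1,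
    fun p hp => (contDiffAt_foliation hh (hoff hp)).contDiffWithinAt, ?_⟩
  rintro _ ⟨t, r, θ, φ, rfl, hr, hrM, h0, h1, hlt⟩
  have hs := Real.sin_pos_of_pos_of_lt_pi h0 h1
  exact ⟨(futureNull_gradient_foliation hh hr hrM hs t φ).1, (hP t r θ φ hr hrM hs).2 hlt.le⟩

/-- One argument for `z_g`, `z_g^{(1)}` and `z_g^{(2)}`: in each case the pointwise condition `P`
off the axis is a weak lower bound on `cot θ`, and the definitions unfold to this union. -/
theorem sUnion_isAdmissible (hh : ∀ r ∈ Set.Ioo 0 (2 * M), HasDerivAt h (profile M r) r)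
    (hF : ContinuousOn F (Set.Ioo 0 (2 * M)))
    (hP : ∀ t r θ φ, 0 < r → r < 2 * M → 0 < Real.sin θ →
      (P (sph t r θ φ) ↔ F r ≤ Real.cot θ)) :
    ⋃₀ {Z | IsAdmissible M h P Z} = cotRegion M F := by
  refine Set.Subset.antisymm ?_
    (Set.subset_sUnion_of_mem (isAdmissible_cotRegion hh hF hP))
  rintro p ⟨Z, ⟨hZo, hZr, hZd, hZ⟩, hp⟩
  obtain ⟨hr, hrM⟩ := hZr hp
  obtain ⟨t, θ, φ, h0, h1, hpe⟩ := exists_eq_sph hr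
  generalize radius p = r at hr hrM hpe
  subst hpe
  have hdiff : DifferentiableAt ℝ (foliation h) (sph t r θ φ) :=
    (hZd.contDiffAt (hZo.mem_nhds hp)).differentiableAt (by norm_num)
  have h0' : 0 < θ := lt_of_le_of_ne h0 fun hc =>
    not_differentiableAt_foliation_axis hr (Or.inl hc.symm) t φ hdiff
  have h1' : θ < Real.pi := lt_of_le_of_ne h1 fun hc =>
    not_differentiableAt_foliation_axis hr (Or.inr hc) t φ hdiff
  refine ⟨t, r, θ, φ, rfl, hr, hrM, h0', h1', ?_⟩
  -- At the point itself only the weak inequality is available. Openness of `Z` allows a slightly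
  -- larger polar angle `s` with the same `r`; the weak inequality at `s` and the strict decrease of
  -- `cot` give the strict one at `θ`.
  have hnear : ∀ᶠ s in 𝓝 θ, sph t r s φ ∈ Z ∧ s < Real.pi :=
    ((continuous_sph_theta t r φ).continuousAt.eventually (hZo.mem_nhds hp)).and
      (gt_mem_nhds h1')
  obtain ⟨s, ⟨hsZ, hsπ⟩, hθs⟩ :=
    ((hnear.filter_mono nhdsWithin_le_nhds).and (self_mem_nhdsWithin (s := Set.Ioi θ))).exists
  have hs := Real.sin_pos_of_pos_of_lt_pi (h0'.trans hθs) hsπ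
  exact ((hP t r s φ hr hrM hs).1 (hZ _ hsZ).2).trans_lt (cot_lt_cot h0' hθs hsπ)

theorem continuousOn_slope (M : ℝ) :
    ContinuousOn (fun r => Real.sqrt ((2 * M - r) / r)) (Set.Ioo 0 (2 * M)) := by
  refine (ContinuousOn.div (by fun_prop) (by fun_prop) fun r hr => hr.1.ne').sqrt

theorem continuousOn_slope_two (M : ℝ) :
    ContinuousOn (fun r => (M - r) / Real.sqrt (r * (2 * M - r))) (Set.Ioo 0 (2 * M)) := by
  refine ContinuousOn.div (by fun_prop) (by fun_prop) fun r hr => ?_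
  exact (Real.sqrt_pos.2 (mul_pos hr.1 (by linarith [hr.2]))).ne'

theorem zSet_one_eq
    (hh : ∀ r ∈ Set.Ioo 0 (2 * M), HasDerivAt h (profile M r) r) :
    (blackHole M).zSet 1 (foliation h)
    = cotRegion M fun r => Real.sqrt ((2 * M - r) / r) :=
  sUnion_isAdmissible hh (continuousOn_slope M) fun t _ _ φ hr hrM hs =>
    levelSetFutureConvexAt_one_iff hh hr hrM hs t φ

theorem zSetPSD_eq
    (hh : ∀ r ∈ Set.Ioo 0 (2 * M), HasDerivAt h (profile M r) r) :
    (blackHole M).zSetPSD (foliation h)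
    = cotRegion M fun r => Real.sqrt ((2 * M - r) / r) :=
  sUnion_isAdmissible hh (continuousOn_slope M) fun t _ _ φ hr hrM hs =>
    hessian_nonneg_iff hh hr hrM hs t φ

theorem zSet_two_eq
    (hh : ∀ r ∈ Set.Ioo 0 (2 * M), HasDerivAt h (profile M r) r) :
    (blackHole M).zSet 2 (foliation h)
    = cotRegion M fun r => (M - r) / Real.sqrt (r * (2 * M - r)) :=
  sUnion_isAdmissible hh (continuousOn_slope_two M) fun t _ _ φ hr hrM hs =>
    levelSetFutureConvexAt_two_iff hh hr hrM hs t φ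

theorem foliatedByFutureConvex_zSet_two
    (hh : ∀ r ∈ Set.Ioo 0 (2 * M), HasDerivAt h (profile M r) r) :
    (blackHole M).FoliatedByFutureConvex 2 (foliation h)
      ((blackHole M).zSet 2 (foliation h)) := by
  rw [zSet_two_eq hh]
  exact isAdmissible_cotRegion hh (continuousOn_slope_two M) fun t _ _ φ hr hrM hs =>
    levelSetFutureConvexAt_two_iff hh hr hrM hs t φ

theorem not_subset_zSet_two_of_isCTM
    (hh : ∀ r ∈ Set.Ioo 0 (2 * M), HasDerivAt h (profile M r) r)
    {S : Set (Fin 4 → ℝ)} (hS : (blackHole M).IsCTM 2 S) :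
    ¬ S ⊆ (blackHole M).zSet 2 (foliation h) := by
  refine (foliatedByFutureConvex_zSet_two hh).not_subset_of_isCTM _ ?_ hS
  rw [zSet_two_eq hh]
  rintro _ ⟨t, r, θ, φ, rfl, hr, hrM, h0, h1, -⟩ v hv
  exact fderiv_foliation_neg hh hr hrM (Real.sin_pos_of_pos_of_lt_pi h0 h1) t φ hv

/-! ### Comparison of the two thresholds -/

/-- In terms of `q` this is `(q² - 1)/(2q) < q`, that is, `q² - 1 < 2q²`. -/
theorem slope_two_lt_slope {r : ℝ} (hr : 0 < r) (hrM : r < 2 * M) :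
    (M - r) / Real.sqrt (r * (2 * M - r)) < Real.sqrt ((2 * M - r) / r) := by
  obtain ⟨q, hq, -, hs, -, -, -, h2⟩ := exists_slope hr hrM
  rw [hs, h2, div_lt_iff₀ (by positivity)]
  nlinarith

theorem exists_cot_eq (c : ℝ) : ∃ θ, 0 < θ ∧ θ < Real.pi ∧ Real.cot θ = c := by
  refine ⟨Real.pi / 2 - Real.arctan c, ?_, ?_, ?_⟩
  · linarith [Real.arctan_lt_pi_div_two c]
  · linarith [Real.neg_pi_div_two_lt_arctan c]
  · rw [Real.cot_eq_cos_div_sin, Real.cos_pi_div_two_sub, Real.sin_pi_div_two_sub,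
      ← Real.tan_eq_sin_div_cos, Real.tan_arctan]

theorem cotRegion_slope_ssubset (hM : 0 < M) :
    cotRegion M (fun r => Real.sqrt ((2 * M - r) / r))
      ⊂ cotRegion M fun r => (M - r) / Real.sqrt (r * (2 * M - r)) := by
  refine (Set.ssubset_iff_of_subset ?_).2 ?_
  · rintro _ ⟨t, r, θ, φ, rfl, hr, hrM, h0, h1, hlt⟩
    exact ⟨t, r, θ, φ, rfl, hr, hrM, h0, h1, (slope_two_lt_slope hr hrM).trans hlt⟩
  · have hrM : M < 2 * M := by linarith
    -- A point on the boundary of the smaller region, where `cot θ` equals its threshold, separates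
    -- the two; the radius `M` is a convenient choice.
    obtain ⟨θ, h0, h1, hc⟩ := exists_cot_eq (Real.sqrt ((2 * M - M) / M))
    refine ⟨sph 0 M θ 0, ?_, ?_⟩
    · rw [sph_mem_cotRegion_iff hM hrM h0 h1, hc]
      exact slope_two_lt_slope hM hrM
    · rw [sph_mem_cotRegion_iff hM hrM h0 h1, hc]
      exact lt_irrefl _

/-! ### Parallels -/

theorem radial_horizontal_eq (hr : 0 < r) (t φ : ℝ) : (![0, Real.cos φ, Real.sin φ, 0] : Fin 4 → ℝ)
    = sphVec t r θ φ 0 (Real.sin θ) (Real.cos θ / r) 0 := by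
  have h1 := hr.ne'
  have e2 := Real.sin_sq_add_cos_sq θ
  ext i
  fin_cases i <;> simp [sphVec, dT_eq, dR_eq, dTheta_eq, dPhi_eq]
  · field_simp; linear_combination -Real.cos φ * e2
  · field_simp; linear_combination -Real.sin φ * e2
  · field_simp; ring

/-- The spherical frame is orthogonal, so projecting off `∂_φ` just deletes the last component. -/
theorem normalPart_smul_dPhi (hr : 0 < r) (hrM : r < 2 * M) (hθ : 0 < Real.sin θ)
    {l : ℝ} (hl : l ≠ 0) (t φ a b c d : ℝ) {e : Fin 1 → Fin 4 → ℝ}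
    (he : e 0 = sphVec t r θ φ 0 0 0 l) :
    (blackHole M).normalPart (sph t r θ φ) e (sphVec t r θ φ a b c d)
      = sphVec t r θ φ a b c 0 := by
  obtain ⟨q, hq, hM, -, -, -, -, -⟩ := exists_slope hr hrM
  have h1 := hr.ne'
  have h2 := hθ.ne'
  have h3 : (((blackHole M).gram (sph t r θ φ) e)⁻¹ 0 0
      * (blackHole M).inner (sph t r θ φ) (sphVec t r θ φ a b c d) (e 0)) = d / l := by
    simp only [Matrix.inv_subsingleton, CoordSpacetime.gram, Matrix.of_apply, he,
      Matrix.diagonal_apply_eq, inner_sphVec hr hq hM, Ring.inverse_eq_inv']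
    simp
    field_simp
  rw [he] at h3
  simp only [CoordSpacetime.normalPart, Finset.univ_unique, Fin.default_eq_zero,
    Finset.sum_singleton, he, h3]
  ext i
  simp [sphVec]
  field_simp
  ring

theorem christoffel_contract {p : Fin 4 → ℝ} (hp : p ∈ region M) (c : Fin 4) (v w : Fin 4 → ℝ) :
    ∑ a, ∑ b, (blackHole M).christoffel p c a b * v a * w b =
      lapse M p * position p c
        * (-(2 * M * (3 * radius p - 4 * M)) / (radius p ^ 3 * (radius p - 2 * M) ^ 2)
            / (2 * radius p)
            * ((v 1 * p 1 + v 2 * p 2 + v 3 * p 3) * (w 1 * p 1 + w 2 * p 2 + w 3 * p 3))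
          + radialCoeff M (radius p) * (v 1 * w 1 + v 2 * w 2 + v 3 * w 3)
          + M / radius p ^ 3 * (v 0 * w 0))
      + (lapse M p)⁻¹ * formT c * (M / radius p ^ 3)
        * ((v 1 * p 1 + v 2 * p 2 + v 3 * p 3) * w 0
          + (w 1 * p 1 + w 2 * p 2 + w 3 * p 3) * v 0) := by
  have key : ∀ A B C D E : ℝ, ∑ a, ∑ b, (D * (A * (position p a * position p b) + B * flat a b
      + C * (formT a * formT b)) + E * (position p a * formT b + position p b * formT a))
        * v a * w b
      = D * (A * ((v 1 * p 1 + v 2 * p 2 + v 3 * p 3) * (w 1 * p 1 + w 2 * p 2 + w 3 * p 3))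
        + B * (v 1 * w 1 + v 2 * w 2 + v 3 * w 3) + C * (v 0 * w 0))
        + E * ((v 1 * p 1 + v 2 * p 2 + v 3 * p 3) * w 0
          + (w 1 * p 1 + w 2 * p 2 + w 3 * p 3) * v 0) := by
    intro A B C D E
    simp [Fin.sum_univ_four, flat, position, formT]
    ring
  rw [← key]
  refine Finset.sum_congr rfl fun a _ => Finset.sum_congr rfl fun b _ => ?_
  rw [christoffel_eq hp, christoffelRadial, christoffelTime]
  ring

/-- The mean curvature vector of a curve that runs inside a parallel. -/
theorem meanCurvature_of_tangent_dPhi (hr : 0 < r) (hrM : r < 2 * M) (hθ : 0 < Real.sin θ)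
    {l k : ℝ} (hl : l ≠ 0) {t φ : ℝ} {x : (Fin 1 → ℝ) → Fin 4 → ℝ} {u : Fin 1 → ℝ}
    (hx : x u = sph t r θ φ) (hx' : partialD x 0 u = l • dPhi t r θ φ)
    (hx'' : partialD (fun w => partialD x 0 w) 0 u
      = (-(l ^ 2 * (r * Real.sin θ))) • ![0, Real.cos φ, Real.sin φ, 0] + k • dPhi t r θ φ) :
    (blackHole M).meanCurvature x u
      = sphVec t r θ φ 0 ((r - 2 * M) / r ^ 2) (Real.cot θ / r ^ 2) 0 := by
  obtain ⟨q, hq, hM, -, -, -, -, -⟩ := exists_slope hr hrM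
  have h1 := hr.ne'
  have h2 := hθ.ne'
  have hp := (sph_mem_offAxis hr hrM hθ t φ).1
  have he : CoordSpacetime.frame x u 0 = sphVec t r θ φ 0 0 0 l := by
    rw [CoordSpacetime.frame, hx']; simp [sphVec]
  have h5 : r - 2 * M = -(r * q ^ 2) := by rw [hM]; ring
  have hf : lapse M (sph t r θ φ) = -q ^ 2 := by
    rw [lapse, radius_sph hr.le, hM]; field_simp; ring
  -- The tangential acceleration `k` is removed by the normal projection, and the factor `l²`
  -- cancels against the inverse Gram matrix. The result is thus independent of the parametrization.
  have hcov : (blackHole M).covD x u 0 0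
      = sphVec t r θ φ 0 (l ^ 2 * Real.sin θ ^ 2 * (2 * M - r))
        (-(l ^ 2 * Real.sin θ * Real.cos θ)) k := by
    ext c
    simp only [CoordSpacetime.covD, hx]
    rw [hx'', christoffel_contract hp, he, sphVec_dot_position, sphVec_dot_sphVec, sphVec_zero,
      hf, radius_sph hr.le, radialCoeff, h5, radial_horizontal_eq hr t φ]
    have hpos : position (sph t r θ φ) c = r * dR t r θ φ c := by
      fin_cases c <;> simp [position, sph, dR_eq] <;> ring
    rw [hpos]
    simp [sphVec]
    field_simp
    rw [hM]
    ring
  have hgram : ((blackHole M).gram (sph t r θ φ) (CoordSpacetime.frame x u))⁻¹ 0 0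
      = (r ^ 2 * (Real.sin θ ^ 2 * (l * l)))⁻¹ := by
    simp only [Matrix.inv_subsingleton, CoordSpacetime.gram, Matrix.of_apply, he,
      Matrix.diagonal_apply_eq, inner_sphVec hr hq hM, Ring.inverse_eq_inv']
    simp
  simp only [CoordSpacetime.meanCurvature, Finset.univ_unique, Fin.default_eq_zero,
    Finset.sum_singleton, hx, hgram, hcov, normalPart_smul_dPhi hr hrM hθ hl _ _ _ _ _ _ he]
  ext i
  simp [sphVec, Real.cot_eq_cos_div_sin]
  field_simp
  ring

/-- The causal character of the mean curvature vector of a parallel. -/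
theorem futureTimelike_meanCurvature_iff (hr : 0 < r) (hrM : r < 2 * M) (t φ : ℝ) :
    (blackHole M).FutureTimelike (sph t r θ φ)
        (sphVec t r θ φ 0 ((r - 2 * M) / r ^ 2) (Real.cot θ / r ^ 2) 0)
      ↔ Real.cot θ ^ 2 < (2 * M - r) / r := by
  obtain ⟨q, hq, hM, -, -, -, hf, -⟩ := exists_slope hr hrM
  have h1 := hr.ne'
  have h2 := hq.ne'
  have hq2 : (2 * M - r) / r = q ^ 2 := by
    rw [sub_div, div_self h1]; linarith
  have hb : (r - 2 * M) / r ^ 2 = -q ^ 2 / r := by rw [hM]; field_simp; ring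
  have hin : (blackHole M).inner (sph t r θ φ)
      (sphVec t r θ φ 0 (-q ^ 2 / r) (Real.cot θ / r ^ 2) 0)
      (sphVec t r θ φ 0 (-q ^ 2 / r) (Real.cot θ / r ^ 2) 0)
      = (Real.cot θ ^ 2 - q ^ 2) / r ^ 2 := by
    rw [inner_sphVec hr hq hM]; field_simp; ring
  -- The radial component `-q²/r` is negative for every `θ`, so the vector lies on the future side
  -- in all cases and only the sign of its norm matters.
  have hneg : (blackHole M).inner (sph t r θ φ)
      (sphVec t r θ φ 0 (-q ^ 2 / r) (Real.cot θ / r ^ 2) 0)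
      ((blackHole M).timeDir (sph t r θ φ)) < 0 := by
    have : (blackHole M).inner (sph t r θ φ)
      (sphVec t r θ φ 0 (-q ^ 2 / r) (Real.cot θ / r ^ 2) 0)
      ((blackHole M).timeDir (sph t r θ φ)) = -(1 / r) := by
      rw [timeDir_sph hr, inner_sphVec hr hq hM]; field_simp; ring
    rw [this]
    exact neg_neg_of_pos (by positivity)
  have hiff : (Real.cot θ ^ 2 - q ^ 2) / r ^ 2 < 0 ↔ Real.cot θ ^ 2 < q ^ 2 := by
    rw [div_lt_iff₀ (by positivity), zero_mul, sub_neg]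
  rw [hb, hq2, ← hiff]
  constructor
  · rintro ⟨-, h⟩
    rwa [hin] at h
  · intro h
    refine ⟨⟨?_, by rw [hin]; exact h.le, hneg⟩, by rwa [hin]⟩
    intro h0
    rw [h0] at hneg
    simp [CoordSpacetime.inner] at hneg

/-! ### Parallels as embedded curves and trapped loops -/

theorem hasDerivAt_sph (t r θ φ : ℝ) : HasDerivAt (sph t r θ) (dPhi t r θ φ) φ := by
  rw [dPhi_eq]
  refine hasDerivAt_pi.2 fun i => ?_
  fin_cases i
  · exact hasDerivAt_const _ _
  · simpa [sph] using (Real.hasDerivAt_cos φ).const_mul (r * Real.sin θ)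
  · simpa [sph] using (Real.hasDerivAt_sin φ).const_mul (r * Real.sin θ)
  · exact hasDerivAt_const _ _

theorem hasDerivAt_dPhi (t r θ φ : ℝ) : HasDerivAt (dPhi t r θ)
    ((-(r * Real.sin θ)) • ![0, Real.cos φ, Real.sin φ, 0]) φ := by
  have : dPhi t r θ = fun φ =>
      ![0, -(r * Real.sin θ * Real.sin φ), r * Real.sin θ * Real.cos φ, 0] :=
    funext fun φ => dPhi_eq t r θ φ
  rw [this]
  refine hasDerivAt_pi.2 fun i => ?_
  fin_cases i
  · simpa using hasDerivAt_const _ _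
  · simpa using ((Real.hasDerivAt_sin φ).const_mul (r * Real.sin θ)).fun_neg
  · simpa using (Real.hasDerivAt_cos φ).const_mul (r * Real.sin θ)
  · simpa using hasDerivAt_const _ _

theorem hasFDerivAt_fin_one {E : Type} [NormedAddCommGroup E] [NormedSpace ℝ E] {γ : ℝ → E}
    {γ' : E} {u : Fin 1 → ℝ} (hγ : HasDerivAt γ γ' (u 0)) :
    HasFDerivAt (fun w : Fin 1 → ℝ => γ (w 0))
      ((ContinuousLinearMap.toSpanSingleton ℝ γ').comp (ContinuousLinearMap.proj 0)) u :=
  HasFDerivAt.comp (f := fun w : Fin 1 → ℝ => w 0) u hγ.hasFDerivAt (hasFDerivAt_apply 0 u)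

theorem partialD_fin_one {E : Type} [NormedAddCommGroup E] [NormedSpace ℝ E] {γ : ℝ → E}
    {γ' : E} {u : Fin 1 → ℝ} (hγ : HasDerivAt γ γ' (u 0)) :
    partialD (fun w : Fin 1 → ℝ => γ (w 0)) 0 u = γ' := by
  rw [partialD, (hasFDerivAt_fin_one hγ).fderiv]
  simp

theorem partialD_parallelCurve (t r θ : ℝ) (u : Fin 1 → ℝ) :
    partialD (parallelCurve t r θ) 0 u = dPhi t r θ (u 0) :=
  partialD_fin_one (hasDerivAt_sph t r θ (u 0))

theorem meanCurvature_parallelCurve (hr : 0 < r) (hrM : r < 2 * M) (hθ : 0 < Real.sin θ) (t : ℝ)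
    (u : Fin 1 → ℝ) : (blackHole M).meanCurvature (parallelCurve t r θ) u
      = sphVec t r θ (u 0) 0 ((r - 2 * M) / r ^ 2) (Real.cot θ / r ^ 2) 0 := by
  refine meanCurvature_of_tangent_dPhi (l := 1) (k := 0) hr hrM hθ one_ne_zero rfl
    (by rw [partialD_parallelCurve, one_smul]) ?_
  simp only [partialD_parallelCurve]
  rw [partialD_fin_one (hasDerivAt_dPhi t r θ (u 0))]
  simp

theorem continuous_sph_phi (t r θ : ℝ) : Continuous (sph t r θ) := by
  unfold sph
  fun_prop

theorem isCompact_parallel (t r θ : ℝ) : IsCompact (parallel t r θ) := by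
  refine Function.Periodic.compact_of_continuous (c := 2 * Real.pi) (fun φ => ?_)
    Real.two_pi_pos.ne' (continuous_sph_phi t r θ)
  simp [sph]

theorem contDiff_parallelCurve (t r θ : ℝ) : ContDiff ℝ ∞ (parallelCurve t r θ) := by
  have h0 : ContDiff ℝ ∞ fun u : Fin 1 → ℝ => u 0 := contDiff_apply ℝ ℝ 0
  refine contDiff_pi.2 fun i => ?_
  fin_cases i
  · exact contDiff_const
  · exact contDiff_const.mul h0.cos
  · exact contDiff_const.mul h0.sin
  · exact contDiff_const

/-- The parameters at distance less than `π / 2` from `φ₀` parametrize half of the parallel. -/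
theorem isLocalParam_parallelCurve (hr : 0 < r) (hθ : 0 < Real.sin θ) (t φ₀ : ℝ) :
    CoordSpacetime.IsLocalParam 1 (parallel t r θ)
      {u | u 0 - φ₀ ∈ Set.Ioo (-(Real.pi / 2)) (Real.pi / 2)} (parallelCurve t r θ) := by
  have hρ : 0 < r * Real.sin θ := mul_pos hr hθ
  have hρ' := hρ.ne'
  have hcos : ∀ φ, Real.cos φ₀ * sph t r θ φ 1 + Real.sin φ₀ * sph t r θ φ 2
      = r * Real.sin θ * Real.cos (φ - φ₀) := by
    intro φ
    rw [Real.cos_sub]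
    simp [sph]
    ring
  have hsin : ∀ φ, (-(Real.sin φ₀ * sph t r θ φ 1) + Real.cos φ₀ * sph t r θ φ 2)
      / (r * Real.sin θ) = Real.sin (φ - φ₀) := by
    intro φ
    rw [Real.sin_sub]
    simp [sph]
    field_simp
    ring
  refine ⟨?_, (contDiff_parallelCurve t r θ).contDiffOn, ?_, ?_, ?_⟩
  · exact isOpen_Ioo.preimage (by fun_prop)
  · intro u _
    have hfd : HasFDerivAt (parallelCurve t r θ) _ u :=
      hasFDerivAt_fin_one (hasDerivAt_sph t r θ (u 0))
    rw [hfd.fderiv]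
    intro v w hvw
    have hne : dPhi t r θ (u 0) ≠ 0 := by
      intro h0
      have h1 := congrFun h0 1
      have h2 := congrFun h0 2
      rw [dPhi_eq] at h1 h2
      simp only [Matrix.cons_val_one, Matrix.cons_val, Pi.zero_apply, neg_eq_zero,
        mul_eq_zero, hr.ne', hθ.ne', false_or] at h1 h2
      have := Real.sin_sq_add_cos_sq (u 0)
      rw [h1, h2] at this
      norm_num at this
    simp only [ContinuousLinearMap.comp_apply, ContinuousLinearMap.proj_apply,
      ContinuousLinearMap.toSpanSingleton_apply] at hvw
    ext i
    rw [Subsingleton.elim i 0]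
    exact smul_left_injective ℝ hne hvw
  -- A continuous left inverse: a rotation by `φ₀` reads off `sin (φ - φ₀)`, and `arcsin` inverts it
  -- on the open interval of half-width `π / 2`.
  · let g : (Fin 4 → ℝ) → Fin 1 → ℝ := fun p _ => φ₀ + Real.arcsin
      ((-(Real.sin φ₀ * p 1) + Real.cos φ₀ * p 2) / (r * Real.sin θ))
    have hg : Continuous g := by
      refine continuous_pi fun _ => continuous_const.add (Real.continuous_arcsin.comp ?_)
      fun_prop
    have hc : Continuous (parallelCurve t r θ) := (contDiff_parallelCurve t r θ).continuous
    refine Topology.IsEmbedding.of_comp (hc.comp continuous_subtype_val) hg ?_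
    have : g ∘ Set.domRestrict {u : Fin 1 → ℝ | u 0 - φ₀ ∈ Set.Ioo (-(Real.pi / 2)) (Real.pi / 2)}
        (parallelCurve t r θ) = Subtype.val := by
      funext ⟨u, hu⟩
      ext i
      rw [Subsingleton.elim i 0]
      change φ₀ + Real.arcsin ((-(Real.sin φ₀ * sph t r θ (u 0) 1)
        + Real.cos φ₀ * sph t r θ (u 0) 2) / (r * Real.sin θ)) = u 0
      rw [hsin, Real.arcsin_sin hu.1.le hu.2.le]
      ring
    rw [this]
    exact Topology.IsEmbedding.subtypeVal
  -- The open half space centred at azimuth `φ₀` meets the parallel exactly where `cos (φ - φ₀) >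
  -- 0`.
  · refine ⟨{p | 0 < Real.cos φ₀ * p 1 + Real.sin φ₀ * p 2},
      isOpen_lt continuous_const (by fun_prop), ?_⟩
    apply Set.Subset.antisymm
    · rintro _ ⟨u, hu, rfl⟩
      refine ⟨⟨u 0, rfl⟩, ?_⟩
      change 0 < Real.cos φ₀ * sph t r θ (u 0) 1 + Real.sin φ₀ * sph t r θ (u 0) 2
      rw [hcos]
      exact mul_pos hρ (Real.cos_pos_of_mem_Ioo hu)
    · rintro _ ⟨⟨φ, rfl⟩, hφ⟩
      rw [Set.mem_ofPred_eq, hcos] at hφ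
      have hc : 0 < Real.cos (φ - φ₀) := pos_of_mul_pos_right hφ hρ.le
      have hs2 := Real.sin_sq_add_cos_sq (φ - φ₀)
      have habs := abs_lt.1 ((sq_lt_one_iff_abs_lt_one _).1
        (by nlinarith : Real.sin (φ - φ₀) ^ 2 < 1))
      -- `φ` need not lie within `π / 2` of `φ₀`; `φ₀ + α` is the representative of the same point
      -- that does.
      set α := Real.arcsin (Real.sin (φ - φ₀)) with hα
      have hsα : Real.sin α = Real.sin (φ - φ₀) := Real.sin_arcsin habs.1.le habs.2.le
      have hcα : Real.cos α = Real.cos (φ - φ₀) := by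
        rw [hα, Real.cos_arcsin, show 1 - Real.sin (φ - φ₀) ^ 2 = Real.cos (φ - φ₀) ^ 2 by linarith,
          Real.sqrt_sq hc.le]
      have e : φ = φ₀ + (φ - φ₀) := by ring
      refine ⟨fun _ => φ₀ + α, ?_, ?_⟩
      · rw [Set.mem_ofPred_eq, add_sub_cancel_left]
        exact ⟨Real.neg_pi_div_two_lt_arcsin.2 habs.1, Real.arcsin_lt_pi_div_two.2 habs.2⟩
      · have hs' : Real.sin (φ₀ + α) = Real.sin φ := by
          rw [e, Real.sin_add, Real.sin_add, hsα, hcα]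
        have hc' : Real.cos (φ₀ + α) = Real.cos φ := by
          rw [e, Real.cos_add, Real.cos_add, hsα, hcα]
        simp [parallelCurve, sph, hs', hc']

theorem isCTM_parallel (hr : 0 < r) (hrM : r < 2 * M) (hθ : 0 < Real.sin θ) (t : ℝ)
    (hc : Real.cot θ ^ 2 < (2 * M - r) / r) : (blackHole M).IsCTM 1 (parallel t r θ) := by
  refine ⟨Set.range_nonempty _, isCompact_parallel t r θ, ?_, ?_⟩
  · rintro _ ⟨φ, rfl⟩
    exact (sph_mem_offAxis hr hrM hθ t φ).1
  · rintro _ ⟨φ, rfl⟩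
    refine ⟨_, _, fun _ => φ, isLocalParam_parallelCurve hr hθ t φ, ?_, rfl, ?_, ?_⟩
    · have := Real.pi_pos
      simp
      linarith
    · obtain ⟨q, hq, hM, -⟩ := exists_slope hr hrM
      have he : ∀ i : Fin 1, CoordSpacetime.frame (parallelCurve t r θ) (fun _ => φ) i
          = sphVec t r θ φ 0 0 0 1 := by
        intro i
        rw [Subsingleton.elim i 0, CoordSpacetime.frame, partialD_parallelCurve, dPhi_eq_sphVec]
      have : (blackHole M).gram (sph t r θ φ)
          (CoordSpacetime.frame (parallelCurve t r θ) (fun _ => φ))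
          = Matrix.diagonal fun _ => r ^ 2 * Real.sin θ ^ 2 := by
        ext i j
        rw [Subsingleton.elim i j]
        simp [CoordSpacetime.gram, he, inner_sphVec hr hq hM]
      rw [this]
      exact Matrix.PosDef.diagonal fun _ => by positivity
    · rw [meanCurvature_parallelCurve hr hrM hθ]
      exact (futureTimelike_meanCurvature_iff hr hrM t φ).2 hc

/-- `IsCTM` provides an arbitrary parametrization `x`, not `parallelCurve`. Differentiating the
equations of the parallel (`x 0` and `x 3` constant, `x 1 ^ 2 + x 2 ^ 2` constant) once and twice
puts the first and second derivatives of `x` into the form required by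
`meanCurvature_of_tangent_dPhi`. A single point suffices. -/
theorem cot_sq_lt_of_isCTM_parallel (hr : 0 < r) (hrM : r < 2 * M) (hθ : 0 < Real.sin θ) {t : ℝ}
    (hS : (blackHole M).IsCTM 1 (parallel t r θ)) : Real.cot θ ^ 2 < (2 * M - r) / r := by
  obtain ⟨-, -, -, hpar⟩ := hS
  obtain ⟨V, x, u, hx, huV, hxu, hgram, hH⟩ := hpar _ ⟨0, rfl⟩
  obtain ⟨O, -, hO⟩ := hx.image
  have hmem : ∀ w ∈ V, ∃ φ, sph t r θ φ = x w := fun w hw => (hO.le ⟨w, hw, rfl⟩).1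
  obtain ⟨φ, hφ⟩ := hmem u huV
  have hC2 : ∀ w ∈ V, ContDiffAt ℝ 2 x w := fun w hw =>
    (hx.contDiffOn.contDiffAt (hx.isOpen.mem_nhds hw)).of_le
      (WithTop.coe_le_coe.2 (le_top : (2 : ℕ∞) ≤ ⊤))
  set δ : ℝ → Fin 1 → ℝ := fun s => u + s • Pi.single 0 1 with hδ
  have hδ' : ∀ s, HasDerivAt δ (Pi.single 0 1) s := fun s => by
    change HasDerivAt (fun s => u + s • Pi.single 0 1) _ s
    simpa using ((hasDerivAt_id s).smul_const (Pi.single 0 1 : Fin 1 → ℝ)).const_add u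
  have hδ0 : δ 0 = u := by simp [hδ]
  set N : Set ℝ := δ ⁻¹' V with hN
  have hNo : IsOpen N := hx.isOpen.preimage (continuous_iff_continuousAt.2 fun s =>
    (hδ' s).continuousAt)
  have h0N : (0 : ℝ) ∈ N := by rw [hN, Set.mem_preimage, hδ0]; exact huV
  have hγ : ∀ s ∈ N, ∀ i, HasDerivAt (fun s => x (δ s) i) (partialD x 0 (δ s) i) s := by
    intro s hs
    exact hasDerivAt_pi.1
      (((hC2 _ hs).differentiableAt (by norm_num)).hasFDerivAt.comp_hasDerivAt s (hδ' s))
  have hγ' : ∀ i, HasDerivAt (fun s => partialD x 0 (δ s) i)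
      (partialD (fun w => partialD x 0 w) 0 u i) 0 := by
    have hd : HasFDerivAt (fun w => partialD x 0 w)
        (fderiv ℝ (fun w => partialD x 0 w) u) (δ 0) := by
      rw [hδ0]; exact ((hC2 u huV).differentiableAt_partialD 0).hasFDerivAt
    exact hasDerivAt_pi.1 (hd.comp_hasDerivAt (0 : ℝ) (hδ' 0))
  have hconst : ∀ {f : ℝ → ℝ} {f' c s : ℝ}, s ∈ N → HasDerivAt f f' s → (∀ s ∈ N, f s = c) →
      f' = 0 := by
    intro f f' c s hs hf hfc
    refine hf.unique ((hasDerivAt_const s c).congr_of_eventuallyEq ?_)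
    filter_upwards [hNo.mem_nhds hs] with w hw using hfc w hw
  have h0 : ∀ s ∈ N, partialD x 0 (δ s) 0 = 0 := fun s hs =>
    hconst (c := t) hs (hγ s hs 0) fun w hw => by
      obtain ⟨φ, hφ⟩ := hmem _ hw
      rw [← hφ]; rfl
  have h3 : ∀ s ∈ N, partialD x 0 (δ s) 3 = 0 := fun s hs =>
    hconst (c := r * Real.cos θ) hs (hγ s hs 3) fun w hw => by
      obtain ⟨φ, hφ⟩ := hmem _ hw
      rw [← hφ]; rfl
  have h12 : ∀ s ∈ N, x (δ s) 1 * partialD x 0 (δ s) 1 + x (δ s) 2 * partialD x 0 (δ s) 2 = 0 := by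
    intro s hs
    have := hconst (c := (r * Real.sin θ) ^ 2) hs
      (((hγ s hs 1).fun_mul (hγ s hs 1)).fun_add ((hγ s hs 2).fun_mul (hγ s hs 2))) fun w hw => by
        obtain ⟨φ, hφ⟩ := hmem _ hw
        rw [← hφ]
        simp [sph]
        linear_combination (r * Real.sin θ) ^ 2 * Real.sin_sq_add_cos_sq φ
    linarith
  have h0' := hconst h0N (hγ' 0) h0
  have h3' := hconst h0N (hγ' 3) h3
  have h12' := hconst h0N
    (((hγ 0 h0N 1).fun_mul (hγ' 1)).fun_add ((hγ 0 h0N 2).fun_mul (hγ' 2))) h12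
  have e0 := h0 0 h0N
  have e3 := h3 0 h0N
  have e12 := h12 0 h0N
  rw [hδ0] at e0 e3 e12
  simp only [hδ0] at h12'
  rw [← hxu] at hgram
  set y := partialD x 0 u with hy
  set z := partialD (fun w => partialD x 0 w) 0 u with hz
  have hρ : r * Real.sin θ ≠ 0 := (mul_pos hr hθ).ne'
  have hr' := hr.ne'
  have hs' := hθ.ne'
  have hcs := Real.sin_sq_add_cos_sq φ
  rw [← hφ] at e12 h12'
  simp only [sph, Matrix.cons_val_one, Matrix.cons_val] at e12 h12'
  have f12 : Real.cos φ * y 1 + Real.sin φ * y 2 = 0 := by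
    apply mul_left_cancel₀ hρ; linarith
  set l := (-(Real.sin φ * y 1) + Real.cos φ * y 2) / (r * Real.sin θ) with hl
  set k := (-(Real.sin φ * z 1) + Real.cos φ * z 2) / (r * Real.sin θ) with hk
  have hl' : l * (r * Real.sin θ) = -(Real.sin φ * y 1) + Real.cos φ * y 2 := by
    rw [hl]; field_simp
  have hk' : k * (r * Real.sin θ) = -(Real.sin φ * z 1) + Real.cos φ * z 2 := by
    rw [hk]; field_simp
  have hyl : y = l • dPhi t r θ φ := by
    rw [dPhi_eq]
    ext i
    fin_cases i
    · simp [e0]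
    · simp
      linear_combination Real.sin φ * hl' - y 1 * hcs + Real.cos φ * f12
    · simp
      linear_combination -Real.cos φ * hl' - y 2 * hcs + Real.sin φ * f12
    · simp [e3]
  -- A vanishing velocity would contradict positive definiteness of the Gram matrix.
  have hl0 : l ≠ 0 := by
    intro hl0
    rw [hl0, zero_smul] at hyl
    have := hgram.diag_pos (i := 0)
    simp [CoordSpacetime.gram, CoordSpacetime.frame, ← hy, hyl, CoordSpacetime.inner] at this
  have hy1 : y 1 = -(l * (r * Real.sin θ * Real.sin φ)) := by
    rw [hyl, dPhi_eq]; simp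
  have hy2 : y 2 = l * (r * Real.sin θ * Real.cos φ) := by
    rw [hyl, dPhi_eq]; simp
  -- The centripetal acceleration, from the second derivative of `x 1 ^ 2 + x 2 ^ 2`.
  have g12 : Real.cos φ * z 1 + Real.sin φ * z 2 = -(l ^ 2 * (r * Real.sin θ)) := by
    apply mul_left_cancel₀ hρ
    rw [hy1, hy2] at h12'
    linear_combination h12' - (l * (r * Real.sin θ)) ^ 2 * hcs
  have hzk : z = (-(l ^ 2 * (r * Real.sin θ))) • ![0, Real.cos φ, Real.sin φ, 0]
      + k • dPhi t r θ φ := by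
    rw [dPhi_eq]
    ext i
    fin_cases i
    · simp [h0']
    · simp
      linear_combination Real.sin φ * hk' - z 1 * hcs + Real.cos φ * g12
    · simp
      linear_combination -Real.cos φ * hk' - z 2 * hcs + Real.sin φ * g12
    · simp [h3']
  rw [meanCurvature_of_tangent_dPhi hr hrM hθ hl0 hφ.symm hyl hzk, ← hxu, ← hφ] at hH
  exact (futureTimelike_meanCurvature_iff hr hrM t φ).1 hH

theorem isCTM_parallel_iff (hr : 0 < r) (hrM : r < 2 * M) (hθ : 0 < Real.sin θ) (t : ℝ) :
    (blackHole M).IsCTM 1 (parallel t r θ) ↔ Real.cot θ ^ 2 < (2 * M - r) / r :=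
  ⟨cot_sq_lt_of_isCTM_parallel hr hrM hθ, isCTM_parallel hr hrM hθ t⟩

/-! ### Position of the parallels relative to the regions -/

theorem cot_sq_lt_iff (hr : 0 < r) (hM : 0 < M) (hθ : 0 < Real.sin θ) :
    Real.cot θ ^ 2 < (2 * M - r) / r ↔ r / (2 * M) < Real.sin θ ^ 2 := by
  have e2 := Real.sin_sq_add_cos_sq θ
  rw [Real.cot_eq_cos_div_sin, div_pow, div_lt_div_iff₀ (by positivity) hr,
    div_lt_iff₀ (by positivity), ← sub_pos, ← sub_pos (b := r)]
  have : (2 * M - r) * Real.sin θ ^ 2 - Real.cos θ ^ 2 * r = Real.sin θ ^ 2 * (2 * M) - r := by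
    linear_combination -r * e2
  rw [this]

theorem parallel_subset_cotRegion_iff {F : ℝ → ℝ} (hr : 0 < r) (hrM : r < 2 * M) (h0 : 0 < θ)
    (h1 : θ < Real.pi) (t : ℝ) : parallel t r θ ⊆ cotRegion M F ↔ F r < Real.cot θ := by
  constructor
  · exact fun H => (sph_mem_cotRegion_iff hr hrM h0 h1).1 (H ⟨0, rfl⟩)
  · rintro H _ ⟨φ, rfl⟩
    exact (sph_mem_cotRegion_iff hr hrM h0 h1).2 H

theorem disjoint_parallel_cotRegion_iff {F : ℝ → ℝ} (hr : 0 < r) (hrM : r < 2 * M) (h0 : 0 < θ)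
    (h1 : θ < Real.pi) (t : ℝ) :
    Disjoint (parallel t r θ) (cotRegion M F) ↔ Real.cot θ ≤ F r := by
  rw [Set.disjoint_left, ← not_lt]
  constructor
  · exact fun H hlt => H ⟨0, rfl⟩ ((sph_mem_cotRegion_iff hr hrM h0 h1).2 hlt)
  · rintro H _ ⟨φ, rfl⟩ hφ
    exact H ((sph_mem_cotRegion_iff hr hrM h0 h1).1 hφ)

theorem exists_trapped_angle (hr : 0 < r) (hrM : r < 2 * M) : ∃ θ, 0 < θ ∧ θ < Real.pi ∧
    Real.cot θ ^ 2 < (2 * M - r) / r ∧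
    (M - r) / Real.sqrt (r * (2 * M - r)) < Real.cot θ := by
  have hpos : 0 < (2 * M - r) / r := div_pos (by linarith) hr
  have hq : 0 < Real.sqrt ((2 * M - r) / r) := Real.sqrt_pos.2 hpos
  -- Being above `-q` and below `q` makes the loop trapped; being above the other threshold puts it
  -- in `z_g^{(2)}`.
  obtain ⟨c, hc1, hc2⟩ := exists_between (max_lt (slope_two_lt_slope hr hrM)
    (by linarith : -Real.sqrt ((2 * M - r) / r) < Real.sqrt ((2 * M - r) / r)))
  obtain ⟨θ, h0, h1, rfl⟩ := exists_cot_eq c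
  rw [max_lt_iff] at hc1
  refine ⟨θ, h0, h1, ?_, hc1.1⟩
  rw [← Real.sq_sqrt hpos.le]
  exact sq_lt_sq' hc1.2 hc2

end Schwarzschild

/-! ### Assembly of the theorem -/

theorem mainTheorem8 (M : ℝ) (hM : 0 < M) (h : ℝ → ℝ)
    (hh : ∀ r ∈ Set.Ioo 0 (2 * M), HasDerivAt h (1 / Real.sqrt (r * (2 * M - r))) r) :
    -- the gradient of `g` off the axis; it is future null
    (∀ t r θ φ : ℝ, 0 < r → r < 2 * M → 0 < θ → θ < Real.pi →
      (Schwarzschild.blackHole M).gradient (Schwarzschild.foliation h) (Schwarzschild.sph t r θ φ) =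
        (-((2 * M - r) / (r * Real.sqrt ((2 * M - r) * r)))) • Schwarzschild.dR t r θ φ
          + (1 / r ^ 2) • Schwarzschild.dTheta t r θ φ ∧
      (Schwarzschild.blackHole M).FutureNull (Schwarzschild.sph t r θ φ)
        ((Schwarzschild.blackHole M).gradient (Schwarzschild.foliation h)
          (Schwarzschild.sph t r θ φ))) ∧
    -- the sets `z_g = z_g^{(1)}` and `z_g^{(2)}`
    (Schwarzschild.blackHole M).zSet 1 (Schwarzschild.foliation h) =
      Schwarzschild.cotRegion M (fun r => Real.sqrt ((2 * M - r) / r)) ∧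
    (Schwarzschild.blackHole M).zSetPSD (Schwarzschild.foliation h) =
      (Schwarzschild.blackHole M).zSet 1 (Schwarzschild.foliation h) ∧
    (Schwarzschild.blackHole M).zSet 2 (Schwarzschild.foliation h) =
      Schwarzschild.cotRegion M (fun r => (M - r) / Real.sqrt (r * (2 * M - r))) ∧
    (Schwarzschild.blackHole M).zSet 1 (Schwarzschild.foliation h) ⊂
      (Schwarzschild.blackHole M).zSet 2 (Schwarzschild.foliation h) ∧
    -- `z_g^{(2)}` is open, and the level sets of `g` are 2-future convex there
    (Schwarzschild.blackHole M).FoliatedByFutureConvex 2 (Schwarzschild.foliation h)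
      ((Schwarzschild.blackHole M).zSet 2 (Schwarzschild.foliation h)) ∧
    -- `z_g^{(2)}` contains no closed trapped surface
    (∀ S : Set (Fin 4 → ℝ), (Schwarzschild.blackHole M).IsCTM 2 S →
      ¬ S ⊆ (Schwarzschild.blackHole M).zSet 2 (Schwarzschild.foliation h)) ∧
    -- the parallels
    (∀ t₀ r₀ θ₀ : ℝ, 0 < r₀ → r₀ < 2 * M → 0 < θ₀ → θ₀ < Real.pi →
      (∀ u : Fin 1 → ℝ, (Schwarzschild.blackHole M).meanCurvature
          (Schwarzschild.parallelCurve t₀ r₀ θ₀) u =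
        ((r₀ - 2 * M) / r₀ ^ 2) • Schwarzschild.dR t₀ r₀ θ₀ (u 0)
          + (Real.cot θ₀ / r₀ ^ 2) • Schwarzschild.dTheta t₀ r₀ θ₀ (u 0)) ∧
      ((Schwarzschild.blackHole M).IsCTM 1 (Schwarzschild.parallel t₀ r₀ θ₀) ↔
        Real.cot θ₀ ^ 2 < (2 * M - r₀) / r₀) ∧
      (Real.cot θ₀ ^ 2 < (2 * M - r₀) / r₀ ↔ r₀ / (2 * M) < Real.sin θ₀ ^ 2) ∧
      (Schwarzschild.parallel t₀ r₀ θ₀ ⊆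
          (Schwarzschild.blackHole M).zSet 2 (Schwarzschild.foliation h) ↔
        (M - r₀) / Real.sqrt (r₀ * (2 * M - r₀)) < Real.cot θ₀) ∧
      -- trapped parallels avoid `z_g^{(1)}`
      ((Schwarzschild.blackHole M).IsCTM 1 (Schwarzschild.parallel t₀ r₀ θ₀) →
        Disjoint (Schwarzschild.parallel t₀ r₀ θ₀)
          ((Schwarzschild.blackHole M).zSet 1 (Schwarzschild.foliation h))) ∧
      (θ₀ ≤ Real.pi / 2 →
        (Disjoint (Schwarzschild.parallel t₀ r₀ θ₀)
            ((Schwarzschild.blackHole M).zSet 1 (Schwarzschild.foliation h)) ↔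
          Real.cot θ₀ ^ 2 ≤ (2 * M - r₀) / r₀))) ∧
    -- every sphere `(t₀, r₀)` has trapped parallels inside `z_g^{(2)}`
    (∀ t₀ r₀ : ℝ, 0 < r₀ → r₀ < 2 * M → ∃ θ₀ : ℝ, 0 < θ₀ ∧ θ₀ < Real.pi ∧
      r₀ / (2 * M) < Real.sin θ₀ ^ 2 ∧
      (Schwarzschild.blackHole M).IsCTM 1 (Schwarzschild.parallel t₀ r₀ θ₀) ∧
      Schwarzschild.parallel t₀ r₀ θ₀ ⊆
        (Schwarzschild.blackHole M).zSet 2 (Schwarzschild.foliation h)) := by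
  have hh' : ∀ r ∈ Set.Ioo 0 (2 * M), HasDerivAt h (Schwarzschild.profile M r) r := hh
  rw [Schwarzschild.zSetPSD_eq hh', Schwarzschild.zSet_one_eq hh']
  refine ⟨?_, rfl, rfl, Schwarzschild.zSet_two_eq hh', ?_,
    Schwarzschild.foliatedByFutureConvex_zSet_two hh',
    fun S => Schwarzschild.not_subset_zSet_two_of_isCTM hh', ?_, ?_⟩
  · intro t r θ φ hr hrM h0 h1
    have hs := Real.sin_pos_of_pos_of_lt_pi h0 h1
    refine ⟨?_, Schwarzschild.futureNull_gradient_foliation hh' hr hrM hs t φ⟩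
    rw [Schwarzschild.gradient_foliation hh' hr hrM hs, Schwarzschild.sphVec,
      Schwarzschild.profile, mul_comm r (2 * M - r)]
    have hq : Real.sqrt ((2 * M - r) * r) ≠ 0 :=
      (Real.sqrt_pos.2 (mul_pos (by linarith) hr)).ne'
    have : 1 / Real.sqrt ((2 * M - r) * r) * (r - 2 * M) / r
        = -((2 * M - r) / (r * Real.sqrt ((2 * M - r) * r))) := by
      field_simp
      ring
    rw [this]
    simp
  · rw [Schwarzschild.zSet_two_eq hh']
    exact Schwarzschild.cotRegion_slope_ssubset hM
  · intro t r θ hr hrM h0 h1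
    have hs := Real.sin_pos_of_pos_of_lt_pi h0 h1
    have hpos : 0 < (2 * M - r) / r := div_pos (by linarith) hr
    rw [Schwarzschild.isCTM_parallel_iff hr hrM hs, Schwarzschild.zSet_two_eq hh',
      Schwarzschild.parallel_subset_cotRegion_iff hr hrM h0 h1,
      Schwarzschild.disjoint_parallel_cotRegion_iff hr hrM h0 h1]
    refine ⟨fun u => ?_, Iff.rfl, Schwarzschild.cot_sq_lt_iff hr hM hs, Iff.rfl,
      fun hc => Real.le_sqrt_of_sq_le hc.le, fun hθ => ?_⟩
    · rw [Schwarzschild.meanCurvature_parallelCurve hr hrM hs, Schwarzschild.sphVec]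
      simp
    -- For `θ ≤ π/2` the cotangent is nonnegative, so the bound `cot θ ≤ q` may be squared without
    -- loss.
    · refine Real.le_sqrt ?_ hpos.le
      rw [Real.cot_eq_cos_div_sin]
      exact div_nonneg (Real.cos_nonneg_of_neg_pi_div_two_le_of_le (by linarith) hθ) hs.le
  · intro t r hr hrM
    obtain ⟨θ, h0, h1, hc, hlt⟩ := Schwarzschild.exists_trapped_angle hr hrM
    have hs := Real.sin_pos_of_pos_of_lt_pi h0 h1
    refine ⟨θ, h0, h1, (Schwarzschild.cot_sq_lt_iff hr hM hs).1 hc,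
      Schwarzschild.isCTM_parallel hr hrM hs t hc, ?_⟩
    rw [Schwarzschild.zSet_two_eq hh', Schwarzschild.parallel_subset_cotRegion_iff hr hrM h0 h1]
    exact hlt
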